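/- Let $\mathbb H$ be the quaternions, $\mathbb D=\{q\in\mathbb H:|q|<1\}$, $\mathbb S$ the set of $j\in\mathbb H$ with $\operatorname{Re} j=0$ and $|j|=1$, and for $j\in\mathbb S$ let $\mathbb C_j=\{x_0+jx_1:x_0,x_1\in\mathbb R\}$ and $\mathbb D_j=\mathbb D\cap\mathbb C_j$. Fix a real number $\alpha>-1$ and $i\in\mathbb S$, and let $dA_{\alpha,i}(z)=\frac{\alpha+1}{\pi}(1-|z|^2)^\alpha\,dm_i(z)$ on $\mathbb D_i$, where $m_i$ is Lebesgue measure on $\mathbb C_i$. A real differentiable function $f:\mathbb D\to\mathbb H$ is called left slice hyperholomorphic if $f(x_0+jx_1)=a(x_0,x_1)+j\,b(x_0,x_1)$ for all $j\in\mathbb S$ and all $x_0+jx_1\in\mathbb D$, with $\mathbb H$-valued differentiable functions $a,b$ satisfying $a(x_0,-x_1)=a(x_0,x_1)$, $b(x_0,-x_1)=-b(x_0,x_1)$, $\partial_{x_0}a=\partial_{x_1}b$ and $\partial_{x_0}b=-\partial_{x_1}a$. Let $\mathcal A=\mathcal A^2_{\alpha,i}(\mathbb D)$ be the right quaternionic Hilbert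 space of all left slice hyperholomorphic $f:\mathbb D\to\mathbb H$ with $\int_{\mathbb D_i}|f|^2\,dA_{\alpha,i}<\infty$, with scalar product $\langle f,g\rangle=\int_{\mathbb D_i}\overline{f(z)}\,g(z)\,dA_{\alpha,i}(z)$ and norm $\|f\|=\langle f,f\rangle^{1/2}$. For $w\in\mathbb D$ let $K_w\in\mathcal A$ be the reproducing kernel, i.e. the unique element with $\langle K_w,f\rangle=f(w)$ for all $f\in\mathcal A$, and let $k_w=K_w/\sqrt{K_w(w)}$. Let $J$ be the operator on $\mathcal A$ that sends $f$ to the unique left slice hyperholomorphic function on $\mathbb D$ whose restriction to $\mathbb D_i$ is $z\mapsto i f(z)$, and let $\mathcal B_J(\mathcal A)$ be the set of bounded right $\mathbb H$-linear operators $T$ on $\mathcal A$ with $TJ=JT$; put $\|T\|=\sup_{\|f\|=1}\|Tf\|$. The Berezin transform of $T\in\mathcal B_J(\mathcal A)$ is $\widetilde T(z)=\langle k_z,Tk_z\rangle$, $z\in\mathbb D_i$. For $z,w\in\mathbb D_i$ let $$\rho(z,w)=\frac{|z-w|}{|1-z\overline w|},\qquad \beta(z,w)=\frac12\log\frac{1+\rho(z,w)}{1-\rho(z,w)}$$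 be the pseudo-hyperbolic and the Bergman metric. **Theorem.** For every $T\in\mathcal B_J(\mathcal A^2_{\alpha,i}(\mathbb D))$, $$|\widetilde T(z)-\widetilde T(w)|\le 2\sqrt{2+\alpha}\,\|T\|\,\beta(z,w)\qquad\text{for all } z,w\in\mathbb D_i.$$ Furthermore the constant is sharp: if $C\in\mathbb R$ is such that $|\widetilde T(z)-\widetilde T(w)|\le C\,\|T\|\,\beta(z,w)$ for all $T\in\mathcal B_J(\mathcal A^2_{\alpha,i}(\mathbb D))$ and all $z,w\in\mathbb D_i$, then $C\ge 2\sqrt{2+\alpha}$. -/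

import Mathlib

open scoped Quaternion
open MeasureTheory MulOpposite

namespace SliceBergman

/-- The sphere `𝕊` of imaginary units of the quaternions. -/
def ImagUnit : Type := {i : ℍ[ℝ] // i.re = 0 ∧ ‖i‖ = 1}

/-- The open unit ball `𝔻` of the quaternions. -/
def unitBall : Set ℍ[ℝ] := Metric.ball 0 1

/-- The point `x₀ + i x₁` of the quaternions. -/
noncomputable def pt (i : ℍ[ℝ]) (x₀ x₁ : ℝ) : ℍ[ℝ] := (x₀ : ℍ[ℝ]) + i * (x₁ : ℍ[ℝ])

/-- The complex plane `ℂ_i = {x₀ + i x₁}`. -/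
def slicePlane (i : ImagUnit) : Set ℍ[ℝ] := {q | ∃ x₀ x₁ : ℝ, q = pt i.1 x₀ x₁}

/-- The slice disc `𝔻_i = 𝔻 ∩ ℂ_i`. -/
def sliceDisc (i : ImagUnit) : Set ℍ[ℝ] := unitBall ∩ slicePlane i

/-- Left slice hyperholomorphic functions on an axially symmetric open set `U`: real differentiable
functions of the form `f (x₀ + i x₁) = a (x₀, x₁) + i b (x₀, x₁)` for every imaginary unit `i`, where
`a` is even and `b` is odd in `x₁` and `a`, `b` satisfy the Cauchy-Riemann system. -/
def IsLeftSliceHyperholomorphicOn (f : ℍ[ℝ] → ℍ[ℝ]) (U : Set ℍ[ℝ]) : Prop :=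
  DifferentiableOn ℝ f U ∧
  ∃ a b : ℝ × ℝ → ℍ[ℝ], ∀ (i : ImagUnit) (x₀ x₁ : ℝ), pt i.1 x₀ x₁ ∈ U →
    f (pt i.1 x₀ x₁) = a (x₀, x₁) + i.1 * b (x₀, x₁) ∧
    a (x₀, -x₁) = a (x₀, x₁) ∧ b (x₀, -x₁) = -b (x₀, x₁) ∧
    DifferentiableAt ℝ a (x₀, x₁) ∧ DifferentiableAt ℝ b (x₀, x₁) ∧
    fderiv ℝ a (x₀, x₁) (1, 0) = fderiv ℝ b (x₀, x₁) (0, 1) ∧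
    fderiv ℝ b (x₀, x₁) (1, 0) = -fderiv ℝ a (x₀, x₁) (0, 1)

/-- The measure `((α + 1) / π) (1 - |z|²) ^ α dm(z)` on the unit disc of `ℂ`. Integrals over `𝔻_i` with
respect to `dA_{α,i}` are integrals against this measure after the isometric identification
`z ↦ z.re + i z.im` of `ℂ` with `ℂ_i`. -/
noncomputable def discMeasure (α : ℝ) : Measure ℂ :=
  (volume.restrict (Metric.ball (0 : ℂ) 1)).withDensity
    fun z => ENNReal.ofReal ((α + 1) / Real.pi * (1 - ‖z‖ ^ 2) ^ α)

/-- The restriction `f_i` of `f` to `ℂ_i`, read as a function on `ℂ`. -/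
noncomputable def restr (i : ImagUnit) (f : ℍ[ℝ] → ℍ[ℝ]) (z : ℂ) : ℍ[ℝ] := f (pt i.1 z.re z.im)

theorem norm_pt_sq (i : ImagUnit) (x y : ℝ) : ‖pt i.1 x y‖ ^ 2 = x ^ 2 + y ^ 2 := by
  obtain ⟨i, h0, h1⟩ := i
  have h2 : Quaternion.normSq i = 1 := by rw [Quaternion.normSq_eq_norm_mul_self, h1]; norm_num
  rw [Quaternion.normSq_def'] at h2
  rw [sq, ← Quaternion.normSq_eq_norm_mul_self, Quaternion.normSq_def']
  simp only [pt, Quaternion.re_add, Quaternion.imI_add, Quaternion.imJ_add, Quaternion.imK_add,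
    Quaternion.re_mul, Quaternion.imI_mul, Quaternion.imJ_mul, Quaternion.imK_mul,
    Quaternion.re_coe, Quaternion.imI_coe, Quaternion.imJ_coe, Quaternion.imK_coe]
  rw [h0] at h2 ⊢
  linear_combination y ^ 2 * h2

theorem pt_mem_unitBall (i : ImagUnit) (x y : ℝ) : pt i.1 x y ∈ unitBall ↔ x ^ 2 + y ^ 2 < 1 := by
  rw [unitBall, mem_ball_zero_iff, ← norm_pt_sq i x y, sq_lt_one_iff₀ (norm_nonneg _)]

theorem IsLeftSliceHyperholomorphicOn.add {f g : ℍ[ℝ] → ℍ[ℝ]} {U : Set ℍ[ℝ]}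
    (hf : IsLeftSliceHyperholomorphicOn f U) (hg : IsLeftSliceHyperholomorphicOn g U) :
    IsLeftSliceHyperholomorphicOn (f + g) U := by
  obtain ⟨hf, a, b, hab⟩ := hf
  obtain ⟨hg, a', b', hab'⟩ := hg
  refine ⟨hf.add hg, a + a', b + b', fun i x y h => ?_⟩
  obtain ⟨h1, h2, h3, h4, h5, h6, h7⟩ := hab i x y h
  obtain ⟨k1, k2, k3, k4, k5, k6, k7⟩ := hab' i x y h
  refine ⟨?_, ?_, ?_, h4.add k4, h5.add k5, ?_, ?_⟩
  · simp only [Pi.add_apply, h1, k1, mul_add]; abel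
  · simp only [Pi.add_apply, h2, k2]
  · simp only [Pi.add_apply, h3, k3]; abel
  · rw [fderiv_add h4 k4, fderiv_add h5 k5]
    simp only [_root_.add_apply, h6, k6]
  · rw [fderiv_add h4 k4, fderiv_add h5 k5]
    simp only [_root_.add_apply, h7, k7]; abel

theorem IsLeftSliceHyperholomorphicOn.mul_const {f : ℍ[ℝ] → ℍ[ℝ]} {U : Set ℍ[ℝ]}
    (hf : IsLeftSliceHyperholomorphicOn f U) (c : ℍ[ℝ]) :
    IsLeftSliceHyperholomorphicOn (fun x => f x * c) U := by
  obtain ⟨hf, a, b, hab⟩ := hf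
  refine ⟨hf.mul_const c, fun p => a p * c, fun p => b p * c, fun i x y h => ?_⟩
  obtain ⟨h1, h2, h3, h4, h5, h6, h7⟩ := hab i x y h
  refine ⟨?_, ?_, ?_, h4.mul_const c, h5.mul_const c, ?_, ?_⟩
  · simp only [h1, add_mul, mul_assoc]
  · simp only [h2]
  · simp only [h3, neg_mul]
  · rw [fderiv_mul_const' h4, fderiv_mul_const' h5]
    simp [h6]
  · rw [fderiv_mul_const' h4, fderiv_mul_const' h5]
    simp [h7]

/-- The weighted slice Bergman space `𝒜²_{α,i}(𝔻)` as a right quaternionic vector space. A function on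
`𝔻` is represented by its extension by zero to the quaternions. -/
noncomputable def bergmanSpace (α : ℝ) (i : ImagUnit) : Submodule (ℍ[ℝ])ᵐᵒᵖ (ℍ[ℝ] → ℍ[ℝ]) where
  carrier := {f | (∀ x, x ∉ unitBall → f x = 0) ∧ IsLeftSliceHyperholomorphicOn f unitBall ∧
    MemLp (restr i f) 2 (discMeasure α)}
  add_mem' := by
    rintro f g ⟨hf, hf', hf''⟩ ⟨hg, hg', hg''⟩
    exact ⟨fun x hx => by simp [hf x hx, hg x hx], hf'.add hg', hf''.add hg''⟩
  zero_mem' := by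
    refine ⟨fun _ _ => rfl, ⟨differentiableOn_const 0, 0, 0, fun i x y _ => ?_⟩, MemLp.zero⟩
    have h0 : DifferentiableAt ℝ (0 : ℝ × ℝ → ℍ[ℝ]) (x, y) := differentiableAt_const 0
    refine ⟨by simp, by simp, by simp, h0, h0, by simp, by simp⟩
  smul_mem' := by
    rintro c f ⟨hf, hf', hf''⟩
    exact ⟨fun x hx => by simp [hf x hx], hf'.mul_const c.unop, hf''.const_smul c⟩

/-- The scalar product `⟨f, g⟩ = ∫_{𝔻_i} conj (f z) g z dA_{α,i}(z)`. -/
noncomputable def bInner {α : ℝ} {i : ImagUnit} (f g : bergmanSpace α i) : ℍ[ℝ] :=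
  ∫ z, star (restr i f z) * restr i g z ∂(discMeasure α)

/-- The norm `‖f‖ = (∫_{𝔻_i} |f z|² dA_{α,i}(z))^{1/2}`. -/
noncomputable def bNorm {α : ℝ} {i : ImagUnit} (f : bergmanSpace α i) : ℝ :=
  √(∫ z, ‖restr i f z‖ ^ 2 ∂(discMeasure α))

/-- The unit `i_x = Im x / |Im x|` (with value `0` at real `x`, where the choice of `i_x` never
matters). -/
noncomputable def unitOf (x : ℍ[ℝ]) : ℍ[ℝ] := x.im * ((‖x.im‖⁻¹ : ℝ) : ℍ[ℝ])

open scoped Classical in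
/-- The left slice hyperholomorphic extension to `𝔻` of a function given on `𝔻_i`, through the
representation formula
`ext g (x) = (1/2) (1 - i_x i) g (x₀ + i x₁) + (1/2) (1 + i_x i) g (x₀ - i x₁)`, `x = x₀ + i_x x₁`. -/
noncomputable def extL (i : ImagUnit) (g : ℍ[ℝ] → ℍ[ℝ]) (x : ℍ[ℝ]) : ℍ[ℝ] :=
  if x ∈ unitBall then
    ((1 / 2 : ℝ) : ℍ[ℝ]) * (1 - unitOf x * i.1) * g (pt i.1 x.re ‖x.im‖) +
      ((1 / 2 : ℝ) : ℍ[ℝ]) * (1 + unitOf x * i.1) * g (pt i.1 x.re (-‖x.im‖))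
  else 0


theorem eq_zero_of_eq_neg {x : ℍ[ℝ]} (h : x = -x) : x = 0 := by
  have h2 : (2 : ℝ) • x = 0 := by
    rw [two_smul]
    nth_rewrite 1 [h]
    exact neg_add_cancel x
  exact (smul_eq_zero.mp h2).resolve_left two_ne_zero

theorem continuous_reIm : Continuous fun x : ℍ[ℝ] => (x.re, ‖x.im‖) :=
  Quaternion.continuous_re.prodMk Quaternion.continuous_im.norm

theorem normSq_eq_re_im (x : ℍ[ℝ]) : ‖x‖ ^ 2 = x.re ^ 2 + ‖x.im‖ ^ 2 := by
  rw [sq, sq ‖x.im‖, ← Quaternion.normSq_eq_norm_mul_self, ← Quaternion.normSq_eq_norm_mul_self,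
    Quaternion.normSq_def', Quaternion.normSq_def']
  simp; ring

theorem abs_re_le_norm (x : ℍ[ℝ]) : |x.re| ≤ ‖x‖ := by
  refine abs_le_of_sq_le_sq ?_ (norm_nonneg _)
  nlinarith [normSq_eq_re_im x, sq_nonneg ‖x.im‖]

theorem norm_im_le_norm (x : ℍ[ℝ]) : ‖x.im‖ ≤ ‖x‖ := by
  refine (sq_le_sq₀ (norm_nonneg _) (norm_nonneg _)).mp ?_
  nlinarith [normSq_eq_re_im x, sq_nonneg x.re]

theorem norm_unitOf_le (x : ℍ[ℝ]) : ‖unitOf x‖ ≤ 1 := by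
  rw [unitOf, norm_mul, Quaternion.norm_coe, norm_inv, norm_norm]
  exact mul_inv_le_one

theorem unitOf_mul_norm (x : ℍ[ℝ]) : unitOf x * ((‖x.im‖ : ℝ) : ℍ[ℝ]) = x.im := by
  rw [unitOf, mul_assoc, ← Quaternion.coe_mul]
  rcases eq_or_ne x.im 0 with h | h
  · simp [h]
  · rw [inv_mul_cancel₀ (norm_ne_zero_iff.mpr h)]; simp

/-- The real part as a continuous real linear map. -/
noncomputable def reL : ℍ[ℝ] →L[ℝ] ℝ :=
  LinearMap.toContinuousLinearMap
    { toFun := fun x => x.re, map_add' := fun _ _ => rfl, map_smul' := fun _ _ => rfl }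

/-- The vector part as a continuous real linear map. -/
noncomputable def imL : ℍ[ℝ] →L[ℝ] ℍ[ℝ] :=
  LinearMap.toContinuousLinearMap
    { toFun := fun x => x.im, map_add' := fun _ _ => by simp, map_smul' := fun _ _ => by simp }

theorem differentiableAt_stem {a b : ℝ × ℝ → ℍ[ℝ]}
    (H : ∀ x y : ℝ, x ^ 2 + y ^ 2 < 1 → a (x, -y) = a (x, y) ∧ b (x, -y) = -b (x, y) ∧
      DifferentiableAt ℝ a (x, y) ∧ DifferentiableAt ℝ b (x, y))
    {q : ℍ[ℝ]} (hq : q ∈ unitBall) :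
    DifferentiableAt ℝ (fun x : ℍ[ℝ] => a (x.re, ‖x.im‖) + unitOf x * b (x.re, ‖x.im‖)) q := by
  have hq1 : q.re ^ 2 + ‖q.im‖ ^ 2 < 1 := by
    rw [← normSq_eq_re_im, sq_lt_one_iff₀ (norm_nonneg _)]
    exact mem_ball_zero_iff.mp hq
  obtain ⟨-, -, ha, hb⟩ := H _ _ hq1
  have hre : DifferentiableAt ℝ (fun x : ℍ[ℝ] => x.re) q := reL.differentiableAt
  have him : DifferentiableAt ℝ (fun x : ℍ[ℝ] => x.im) q := imL.differentiableAt
  rcases eq_or_ne q.im 0 with h0 | h0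
  · rw [h0, norm_zero] at ha hb hq1
    have hop : ∀ᶠ t : ℝ in nhds 0, (q.re + t) ^ 2 + 0 ^ 2 < 1 :=
      (continuous_const.add continuous_id |>.pow 2 |>.add continuous_const).continuousAt.eventually_lt
        continuousAt_const (by simpa using hq1)
    have hop' : ∀ᶠ t : ℝ in nhds 0, q.re ^ 2 + t ^ 2 < 1 :=
      (continuous_const.add (continuous_id.pow 2)).continuousAt.eventually_lt
        continuousAt_const (by simpa using hq1)
    have hb0 : ∀ x : ℝ, x ^ 2 + 0 ^ 2 < 1 → b (x, 0) = 0 := by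
      intro x hx
      have := (H x 0 hx).2.1
      rw [neg_zero] at this
      exact eq_zero_of_eq_neg this
    have hA : fderiv ℝ a (q.re, 0) (0, 1) = 0 := by
      have l1 : HasDerivAt (fun t : ℝ => (q.re, t)) ((0 : ℝ), (1 : ℝ)) 0 :=
        (hasDerivAt_const _ _).prodMk (hasDerivAt_id _)
      have l2 : HasDerivAt (fun t : ℝ => (q.re, -t)) ((0 : ℝ), (-1 : ℝ)) 0 :=
        (hasDerivAt_const _ _).prodMk (hasDerivAt_id _).neg
      have d1 := HasFDerivAt.comp_hasDerivAt (0 : ℝ) (l := a) (f := fun t : ℝ => (q.re, t))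
        ha.hasFDerivAt l1
      have d2 := HasFDerivAt.comp_hasDerivAt (0 : ℝ) (l := a) (l' := fderiv ℝ a (q.re, 0))
        (f := fun t : ℝ => (q.re, -t)) (by simpa using ha.hasFDerivAt) l2
      have d3 := d2.congr_of_eventuallyEq (f₁ := a ∘ fun t : ℝ => (q.re, t)) (by
        filter_upwards [hop'] with t ht
        exact (H _ _ ht).1.symm)
      have e := d1.unique d3
      have e2 : ((0 : ℝ), (-1 : ℝ)) = -((0 : ℝ), (1 : ℝ)) := by simp
      rw [e2, map_neg] at e
      exact eq_zero_of_eq_neg e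
    have hB : fderiv ℝ b (q.re, 0) (1, 0) = 0 := by
      have l1 : HasDerivAt (fun t : ℝ => (q.re + t, (0 : ℝ))) ((1 : ℝ), (0 : ℝ)) 0 :=
        ((hasDerivAt_id _).const_add _).prodMk (hasDerivAt_const _ _)
      have d1 := HasFDerivAt.comp_hasDerivAt (0 : ℝ) (l := b) (l' := fderiv ℝ b (q.re, 0))
        (f := fun t : ℝ => (q.re + t, (0 : ℝ))) (by simpa using hb.hasFDerivAt) l1
      have d3 := (hasDerivAt_const (0 : ℝ) (0 : ℍ[ℝ])).congr_of_eventuallyEq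
        (f₁ := b ∘ fun t : ℝ => (q.re + t, (0 : ℝ))) (by
        filter_upwards [hop] with t ht
        exact hb0 _ ht)
      exact d1.unique d3
    have hT : Filter.Tendsto (fun x : ℍ[ℝ] => (x.re, ‖x.im‖)) (nhds q) (nhds (q.re, 0)) := by
      have := continuous_reIm.tendsto q
      rwa [h0, norm_zero] at this
    have hO : (fun x : ℍ[ℝ] => ((x.re, ‖x.im‖) : ℝ × ℝ) - (q.re, 0)) =O[nhds q]
        fun x => x - q := by
      refine Asymptotics.IsBigO.of_bound 1 (Filter.Eventually.of_forall fun x => ?_)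
      have k1 : |x.re - q.re| ≤ ‖x - q‖ := by simpa using abs_re_le_norm (x - q)
      have k2 : ‖x.im‖ ≤ ‖x - q‖ := by simpa [h0] using norm_im_le_norm (x - q)
      simp only [Prod.mk_sub_mk, sub_zero, one_mul, Prod.norm_mk, Real.norm_eq_abs, abs_norm]
      exact max_le k1 k2
    have oa := (ha.hasFDerivAt.isLittleO.comp_tendsto hT).trans_isBigO hO
    have ob := (hb.hasFDerivAt.isLittleO.comp_tendsto hT).trans_isBigO hO
    have hsplit : ∀ (L : ℝ × ℝ →L[ℝ] ℍ[ℝ]) (s t : ℝ), L (s, t) = s • L (1, 0) + t • L (0, 1) := by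
      intro L s t
      rw [← map_smul, ← map_smul, ← map_add]
      simp
    have da : DifferentiableAt ℝ (fun x : ℍ[ℝ] => a (x.re, ‖x.im‖)) q := by
      have : HasFDerivAt (fun x : ℍ[ℝ] => a (x.re, ‖x.im‖))
          (reL.smulRight (fderiv ℝ a (q.re, 0) (1, 0))) q := by
        rw [hasFDerivAt_iff_isLittleO]
        refine oa.congr_left fun x => ?_
        simp only [Function.comp, Prod.mk_sub_mk, sub_zero, hsplit _ (x.re - q.re), hA, smul_zero,
          add_zero, h0, norm_zero]
        simp only [ContinuousLinearMap.smulRight_apply, map_sub, ← sub_smul]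
        rfl
      exact this.differentiableAt
    have db : DifferentiableAt ℝ (fun x : ℍ[ℝ] => unitOf x * b (x.re, ‖x.im‖)) q := by
      have o2 : (fun x : ℍ[ℝ] => unitOf x * ((fun p => b p - b (q.re, 0) -
          fderiv ℝ b (q.re, 0) (p - (q.re, 0))) ∘ fun x : ℍ[ℝ] => (x.re, ‖x.im‖)) x)
          =o[nhds q] fun x => x - q := by
        refine Asymptotics.IsBigO.trans_isLittleO ?_ ob
        refine Asymptotics.IsBigO.of_bound 1 (Filter.Eventually.of_forall fun x => ?_)
        rw [norm_mul]
        exact mul_le_mul_of_nonneg_right (norm_unitOf_le x) (norm_nonneg _)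
      have : HasFDerivAt (fun x : ℍ[ℝ] => unitOf x * b (x.re, ‖x.im‖))
          (((ContinuousLinearMap.mul ℝ ℍ[ℝ]).flip (fderiv ℝ b (q.re, 0) (0, 1))).comp imL) q := by
        rw [hasFDerivAt_iff_isLittleO]
        refine o2.congr_left fun x => ?_
        simp only [Function.comp, Prod.mk_sub_mk, sub_zero, hsplit _ (x.re - q.re), hB, smul_zero,
          zero_add, h0, norm_zero, hb0 _ hq1, mul_zero, mul_sub]
        have e : unitOf x * ‖x.im‖ • fderiv ℝ b (q.re, 0) (0, 1) =
            x.im * fderiv ℝ b (q.re, 0) (0, 1) := by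
          rw [← Quaternion.coe_mul_eq_smul, ← mul_assoc, unitOf_mul_norm]
        rw [e]
        simp [imL, h0]
      exact this.differentiableAt
    exact da.add db
  · have hn : DifferentiableAt ℝ (fun x : ℍ[ℝ] => ‖x.im‖) q := him.norm ℝ h0
    have hφ : DifferentiableAt ℝ (fun x : ℍ[ℝ] => (x.re, ‖x.im‖)) q := hre.prodMk hn
    have hu : DifferentiableAt ℝ unitOf q := by
      have h1 : DifferentiableAt ℝ (fun x : ℍ[ℝ] => ‖x.im‖⁻¹ • x.im) q :=
        (hn.inv (norm_ne_zero_iff.mpr h0)).smul him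
      have h2 : unitOf = fun x : ℍ[ℝ] => ‖x.im‖⁻¹ • x.im := by
        funext x
        rw [unitOf, Quaternion.mul_coe_eq_smul]
      rwa [h2]
    exact (DifferentiableAt.comp q (g := a) ha hφ).add
      (hu.mul (DifferentiableAt.comp q (g := b) hb hφ))

theorem unit_mul_self (i : ImagUnit) : i.1 * i.1 = -1 := by
  obtain ⟨i, h0, h1⟩ := i
  have h2 : Quaternion.normSq i = 1 := by rw [Quaternion.normSq_eq_norm_mul_self, h1]; norm_num
  have h3 : star i = -i := Quaternion.star_eq_neg.mpr h0
  have h4 := Quaternion.self_mul_star i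
  rw [h3, h2, mul_neg] at h4
  simpa [neg_eq_iff_eq_neg] using h4

theorem pt_re (i : ImagUnit) (x y : ℝ) : (pt i.1 x y).re = x := by
  simp [pt, i.2.1]

theorem pt_im (i : ImagUnit) (x y : ℝ) : (pt i.1 x y).im = y • i.1 := by
  ext <;> simp [pt, i.2.1, mul_comm]

theorem norm_pt_im (i : ImagUnit) (x y : ℝ) : ‖(pt i.1 x y).im‖ = |y| := by
  rw [pt_im, norm_smul, i.2.2, mul_one, Real.norm_eq_abs]

theorem extL_apply (i : ImagUnit) {f : ℍ[ℝ] → ℍ[ℝ]} {a b : ℝ × ℝ → ℍ[ℝ]} {x : ℍ[ℝ]} (hx : x ∈ unitBall)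
    (H : ∀ (i : ImagUnit) (x₀ x₁ : ℝ), pt i.1 x₀ x₁ ∈ unitBall →
      f (pt i.1 x₀ x₁) = a (x₀, x₁) + i.1 * b (x₀, x₁) ∧
      a (x₀, -x₁) = a (x₀, x₁) ∧ b (x₀, -x₁) = -b (x₀, x₁)) :
    extL i (fun z => i.1 * f z) x =
      i.1 * a (x.re, ‖x.im‖) + unitOf x * (i.1 * b (x.re, ‖x.im‖)) := by
  have h1 : x.re ^ 2 + ‖x.im‖ ^ 2 < 1 := by
    rw [← normSq_eq_re_im, sq_lt_one_iff₀ (norm_nonneg _)]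
    exact mem_ball_zero_iff.mp hx
  obtain ⟨e1, e2, e3⟩ := H i x.re ‖x.im‖ ((pt_mem_unitBall _ _ _).mpr h1)
  obtain ⟨e4, -, -⟩ := H i x.re (-‖x.im‖) ((pt_mem_unitBall _ _ _).mpr (by simpa using h1))
  rw [extL, if_pos hx, e1, e4, e2, e3]
  generalize a (x.re, ‖x.im‖) = A
  generalize b (x.re, ‖x.im‖) = B
  generalize unitOf x = u
  have k1 : i.1 * (A + i.1 * B) = i.1 * A - B := by
    rw [mul_add, ← mul_assoc i.1 i.1 B, unit_mul_self]; simp [sub_eq_add_neg]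
  have k2 : i.1 * (A + i.1 * -B) = i.1 * A + B := by
    rw [mul_add, ← mul_assoc i.1 i.1 (-B), unit_mul_self]; simp
  rw [k1, k2, mul_assoc, mul_assoc, ← mul_add]
  have k3 : (1 - u * i.1) * (i.1 * A - B) + (1 + u * i.1) * (i.1 * A + B) =
      (2 : ℝ) • (i.1 * A + u * (i.1 * B)) := by
    rw [two_smul]; noncomm_ring
  rw [k3, Quaternion.coe_mul_eq_smul, smul_smul]
  norm_num

theorem extL_pt (i k : ImagUnit) {f : ℍ[ℝ] → ℍ[ℝ]} {a b : ℝ × ℝ → ℍ[ℝ]} {x y : ℝ} (hx : pt k.1 x y ∈ unitBall)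
    (H : ∀ (i : ImagUnit) (x₀ x₁ : ℝ), pt i.1 x₀ x₁ ∈ unitBall →
      f (pt i.1 x₀ x₁) = a (x₀, x₁) + i.1 * b (x₀, x₁) ∧
      a (x₀, -x₁) = a (x₀, x₁) ∧ b (x₀, -x₁) = -b (x₀, x₁)) :
    extL i (fun z => i.1 * f z) (pt k.1 x y) = i.1 * a (x, y) + k.1 * (i.1 * b (x, y)) := by
  obtain ⟨-, e2, e3⟩ := H k x y hx
  rw [extL_apply i hx H, unitOf, norm_pt_im, pt_re, pt_im]
  rcases lt_trichotomy y 0 with h | h | h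
  · have h1 : y • k.1 * ((|y|⁻¹ : ℝ) : ℍ[ℝ]) = -k.1 := by
      rw [Quaternion.mul_coe_eq_smul, smul_smul, abs_of_neg h]
      have : (-y)⁻¹ * y = -1 := by rw [inv_neg, neg_mul, inv_mul_cancel₀ h.ne]
      rw [this]; simp
    rw [h1, abs_of_neg h, e2, e3]; simp
  · subst h
    have hb : b (x, 0) = 0 := by
      rw [neg_zero] at e3
      exact eq_zero_of_eq_neg e3
    simp [hb]
  · have h1 : y • k.1 * ((|y|⁻¹ : ℝ) : ℍ[ℝ]) = k.1 := by
      rw [Quaternion.mul_coe_eq_smul, smul_smul, abs_of_pos h, inv_mul_cancel₀ h.ne', one_smul]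
    rw [h1, abs_of_pos h]

theorem extL_mem {α : ℝ} {i : ImagUnit} {f : ℍ[ℝ] → ℍ[ℝ]} (hf : f ∈ bergmanSpace α i) :
    extL i (fun z => i.1 * f z) ∈ bergmanSpace α i := by
  obtain ⟨hf0, ⟨-, a, b, hab⟩, hL⟩ := hf
  have H : ∀ (i : ImagUnit) (x₀ x₁ : ℝ), pt i.1 x₀ x₁ ∈ unitBall →
      f (pt i.1 x₀ x₁) = a (x₀, x₁) + i.1 * b (x₀, x₁) ∧
      a (x₀, -x₁) = a (x₀, x₁) ∧ b (x₀, -x₁) = -b (x₀, x₁) := fun i x y h =>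
    ⟨(hab i x y h).1, (hab i x y h).2.1, (hab i x y h).2.2.1⟩
  refine ⟨fun x hx => by rw [extL, if_neg hx], ⟨?_, fun p => i.1 * a p, fun p => i.1 * b p, ?_⟩, ?_⟩
  · intro q hq
    refine ((differentiableAt_stem (a := fun p => i.1 * a p) (b := fun p => i.1 * b p)
      (fun x y hxy => ?_) hq).congr_of_eventuallyEq ?_).differentiableWithinAt
    · obtain ⟨-, h2, h3, h4, h5, -, -⟩ := hab i x y ((pt_mem_unitBall _ _ _).mpr hxy)
      exact ⟨by simp [h2], by simp [h3], h4.const_mul _, h5.const_mul _⟩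
    · filter_upwards [Metric.isOpen_ball.mem_nhds hq] with x hx
      exact extL_apply i hx H
  · intro k x y h
    obtain ⟨-, h2, h3, h4, h5, h6, h7⟩ := hab k x y h
    refine ⟨extL_pt i k h H, by simp [h2], by simp [h3], h4.const_mul _, h5.const_mul _, ?_, ?_⟩
    · rw [fderiv_const_mul h4, fderiv_const_mul h5]; simp [h6]
    · rw [fderiv_const_mul h4, fderiv_const_mul h5]; simp [h7]
  · have e : restr i (extL i fun z => i.1 * f z) = fun z => i.1 * restr i f z := by
      funext z
      by_cases hz : pt i.1 z.re z.im ∈ unitBall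
      · rw [restr, extL_pt i i hz H, restr, (H i _ _ hz).1, mul_add]
      · rw [restr, extL, if_neg hz, restr, hf0 _ hz, mul_zero]
    rw [e]
    exact hL.const_mul i.1

/-- The operator `J f = ext (i f_i)`. -/
noncomputable def opJ (α : ℝ) (i : ImagUnit) : bergmanSpace α i →ₗ[(ℍ[ℝ])ᵐᵒᵖ] bergmanSpace α i where
  toFun f := ⟨extL i fun z => i.1 * f.1 z, extL_mem f.2⟩
  map_add' f g := by
    ext1; funext x
    simp only [Submodule.coe_add, Pi.add_apply, extL, mul_add]
    split_ifs
    · abel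
    · abel
  map_smul' c f := by
    ext1; funext x
    simp only [SetLike.val_smul, Pi.smul_apply, extL, RingHom.id_apply, smul_eq_mul_unop]
    split_ifs
    · simp only [add_mul, mul_assoc]
    · simp

/-- A right linear operator `T` is bounded if `sup {‖T f‖ : ‖f‖ = 1} < ∞`. -/
def IsBoundedOp {α : ℝ} {i : ImagUnit} (T : bergmanSpace α i →ₗ[(ℍ[ℝ])ᵐᵒᵖ] bergmanSpace α i) : Prop :=
  BddAbove {r : ℝ | ∃ f : bergmanSpace α i, bNorm f = 1 ∧ r = bNorm (T f)}

/-- The operator norm `‖T‖ = sup {‖T f‖ : ‖f‖ = 1}`. -/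
noncomputable def opNorm {α : ℝ} {i : ImagUnit}
    (T : bergmanSpace α i →ₗ[(ℍ[ℝ])ᵐᵒᵖ] bergmanSpace α i) : ℝ :=
  sSup {r : ℝ | ∃ f : bergmanSpace α i, bNorm f = 1 ∧ r = bNorm (T f)}

/-- The set `B_J` of bounded right linear operators on the Bergman space that commute with `J`. -/
def boundedCommJ (α : ℝ) (i : ImagUnit) :
    Set (bergmanSpace α i →ₗ[(ℍ[ℝ])ᵐᵒᵖ] bergmanSpace α i) :=
  {T | IsBoundedOp T ∧ T ∘ₗ opJ α i = opJ α i ∘ₗ T}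

/-- The reproducing kernel function `K_w`: the (unique) element of the Bergman space with
`⟨K_w, f⟩ = f w` for every `f` in the space. -/
noncomputable def kernel (α : ℝ) (i : ImagUnit) (w : ℍ[ℝ]) : bergmanSpace α i :=
  Classical.epsilon fun K => ∀ f : bergmanSpace α i, bInner K f = f.1 w

/-- The normalized reproducing kernel `k_w = K_w / √(K_w w)`; here `K_w w = ‖K_w‖²` is real. -/
noncomputable def normKernel (α : ℝ) (i : ImagUnit) (w : ℍ[ℝ]) : bergmanSpace α i :=
  op (((√((kernel α i w).1 w).re)⁻¹ : ℝ) : ℍ[ℝ]) • kernel α i w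

/-- The Berezin transform `T̃ z = ⟨k_z, T k_z⟩`. -/
noncomputable def berezin {α : ℝ} {i : ImagUnit}
    (T : bergmanSpace α i →ₗ[(ℍ[ℝ])ᵐᵒᵖ] bergmanSpace α i) (z : ℍ[ℝ]) : ℍ[ℝ] :=
  bInner (normKernel α i z) (T (normKernel α i z))

/-- The pseudo-hyperbolic metric on a slice disc. -/
noncomputable def pseudoHyp (z w : ℍ[ℝ]) : ℝ := ‖z - w‖ / ‖1 - z * star w‖

/-- The Bergman metric on a slice disc. -/
noncomputable def bergmanMetric (z w : ℍ[ℝ]) : ℝ :=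
  1 / 2 * Real.log ((1 + pseudoHyp z w) / (1 - pseudoHyp z w))

end SliceBergman

/-! For unit vectors `u`, `v` with real scalar product `c`, polarization writes `2 (⟨u, T u⟩ - ⟨v, T
v⟩)` as `⟨u - v, T (u + v)⟩ + ⟨u + v, T (u - v)⟩`, and `‖u - v‖ ‖u + v‖ = 2 √(1 - c²)`. Hence the
two diagonal values differ by at most `2 ‖T‖ √(1 - c²)` (`norm_bInner_apply_sub_le`).

For `u = k_z`, `v = k_w` the scalar product lies in `ℂ_i` and can be made real by a unimodular
factor from `ℂ_i` on the right of `k_w`. Commutation with `J` is what makes this harmless: it forces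
`⟨k_w, T k_w⟩` to commute with `ℂ_i`, so the factor cancels (`bInner_smul_apply_smul`). Since
`|⟨k_z, k_w⟩|² = (1 - ρ²)^(α + 2)`, the upper bound reduces to the scalar inequality `1 - (1 - ρ²)^s
≤ s (artanh ρ)²` (`one_sub_rpow_le_artanh`), because `β = artanh ρ`.

All this needs the kernel explicitly. It is the slice extension of `(1 - w̄ z)^(-(α + 2))`; the
reproducing property follows from the mean value property at `0` by the Möbius change of variables
exchanging `0` and `w` (`weight_change`, `integral_star_discKernel_smul_aux`).

For sharpness, take the orthonormal pair `u = 1`, `v = √(α + 2) z` and the operator that swaps them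
and kills their orthogonal complement. Its norm is at most `1`, and its Berezin transform at real
`r` is `2 √(α + 2) r (1 - r²)^(α + 2)`, whose slope at `0` is the claimed constant, while `artanh r
~ r`. -/

namespace SliceBergman

/-! ### The weighted measure on the disc: total mass and second moment. -/

/-- The density of `discMeasure`. -/
noncomputable def discWeight (α : ℝ) (z : ℂ) : ℝ := (α + 1) / Real.pi * (1 - ‖z‖ ^ 2) ^ α

theorem measurable_discWeight (α : ℝ) : Measurable (discWeight α) :=
  (((measurable_norm.pow_const 2).const_sub 1).pow_const α).const_mul _

theorem discWeight_nonneg {α : ℝ} (hα : -1 < α) {z : ℂ} (hz : z ∈ Metric.ball (0 : ℂ) 1) :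
    0 ≤ discWeight α z := by
  have h : ‖z‖ < 1 := mem_ball_zero_iff.mp hz
  refine mul_nonneg (div_nonneg (by linarith) Real.pi_pos.le) (Real.rpow_nonneg ?_ _)
  nlinarith [norm_nonneg z]

theorem discMeasure_eq (α : ℝ) : discMeasure α = (volume.restrict (Metric.ball (0 : ℂ) 1)).withDensity
    fun z => ENNReal.ofReal (discWeight α z) := rfl

theorem ae_mem_ball_discMeasure (α : ℝ) : ∀ᵐ z ∂discMeasure α, z ∈ Metric.ball (0 : ℂ) 1 :=
  (withDensity_absolutelyContinuous _ _).ae_le (ae_restrict_mem Metric.isOpen_ball.measurableSet)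

section

variable {E : Type*} [NormedAddCommGroup E] [NormedSpace ℝ E] {α : ℝ}

theorem integral_discMeasure (hα : -1 < α) (g : ℂ → E) :
    ∫ z, g z ∂discMeasure α = ∫ z in Metric.ball (0 : ℂ) 1, discWeight α z • g z := by
  rw [discMeasure_eq, integral_withDensity_eq_integral_toReal_smul
    (measurable_discWeight α).ennreal_ofReal (by simp)]
  refine setIntegral_congr_fun Metric.isOpen_ball.measurableSet fun z hz => ?_
  simp only [ENNReal.toReal_ofReal (discWeight_nonneg hα hz)]

theorem integrable_discMeasure_iff (hα : -1 < α) {g : ℂ → E} :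
    Integrable g (discMeasure α) ↔
      IntegrableOn (fun z => discWeight α z • g z) (Metric.ball (0 : ℂ) 1) := by
  rw [discMeasure_eq, integrable_withDensity_iff_integrable_smul'
    (measurable_discWeight α).ennreal_ofReal (by simp)]
  refine integrableOn_congr_fun (fun z hz => ?_) Metric.isOpen_ball.measurableSet
  simp only [ENNReal.toReal_ofReal (discWeight_nonneg hα hz)]

end

/-- In polar coordinates the mass of the disc becomes the integral of this derivative over `(0, 1)`,
so an elementary primitive evaluates it. -/
theorem hasDerivAt_radial_primitive (α : ℝ) {x : ℝ} (hx : x ∈ Set.Ioo (0 : ℝ) 1) :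
    HasDerivAt (fun x : ℝ => -(1 - x ^ 2) ^ (α + 1)) (2 * (α + 1) * (x * (1 - x ^ 2) ^ α)) x := by
  have h1 : 0 < 1 - x ^ 2 := by nlinarith [hx.1, hx.2]
  have h2 : HasDerivAt (fun x : ℝ => 1 - x ^ 2) (-(2 * x)) x := by
    simpa using (hasDerivAt_pow 2 x).const_sub 1
  refine (h2.rpow_const (p := α + 1) (Or.inl h1.ne')).neg.congr_deriv ?_
  rw [add_sub_cancel_right]; ring

theorem continuousOn_radial_primitive {α : ℝ} (hα : -1 < α) :
    ContinuousOn (fun x : ℝ => -(1 - x ^ 2) ^ (α + 1)) (Set.Icc 0 1) := by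
  refine Continuous.continuousOn (Continuous.neg ?_)
  exact (continuous_const.sub (continuous_id.pow 2)).rpow_const fun x => Or.inr (by linarith)

/-- For `α < 0` the integrand is unbounded at `1`. It is integrable as a nonnegative derivative of a
function continuous up to the endpoint. -/
theorem integrableOn_radial {α : ℝ} (hα : -1 < α) :
    IntegrableOn (fun x : ℝ => 2 * (α + 1) * (x * (1 - x ^ 2) ^ α)) (Set.Ioc 0 1) := by
  refine intervalIntegral.integrableOn_deriv_of_nonneg (continuousOn_radial_primitive hα)
    (fun x hx => hasDerivAt_radial_primitive α hx) fun x hx => ?_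
  have h1 : 0 < 1 - x ^ 2 := by nlinarith [hx.1, hx.2]
  have := hx.1
  have : 0 < α + 1 := by linarith
  positivity

theorem integral_radial {α : ℝ} (hα : -1 < α) :
    ∫ x in Set.Ioc (0 : ℝ) 1, 2 * (α + 1) * (x * (1 - x ^ 2) ^ α) = 1 := by
  rw [← intervalIntegral.integral_of_le zero_le_one,
    intervalIntegral.integral_eq_sub_of_hasDerivAt_of_le zero_le_one
      (continuousOn_radial_primitive hα) (fun x hx => hasDerivAt_radial_primitive α hx)
      ((intervalIntegrable_iff_integrableOn_Ioc_of_le zero_le_one).mpr (integrableOn_radial hα))]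
  simp [Real.zero_rpow (show α + 1 ≠ 0 by linarith)]

theorem integrableOn_discWeight {α : ℝ} (hα : -1 < α) :
    IntegrableOn (discWeight α) (Metric.ball (0 : ℂ) 1) := by
  have h := integrableOn_fun_norm_addHaar (volume : Measure ℂ) (r := 1)
    (f := fun r => (α + 1) / Real.pi * (1 - r ^ 2) ^ α)
  refine h.mpr ?_
  have h2 : IntegrableOn (fun x : ℝ => (2 * Real.pi)⁻¹ * (2 * (α + 1) * (x * (1 - x ^ 2) ^ α)))
      (Set.Ioo 0 1) :=
    ((integrableOn_radial hα).mono_set Set.Ioo_subset_Ioc_self).const_mul _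
  refine h2.congr_fun (fun x _ => ?_) measurableSet_Ioo
  have := Real.pi_ne_zero
  simp only [Complex.finrank_real_complex, smul_eq_mul, Nat.add_one_sub_one, pow_one]
  field_simp

theorem setIntegral_discWeight {α : ℝ} (hα : -1 < α) :
    ∫ z in Metric.ball (0 : ℂ) 1, discWeight α z = 1 := by
  have h := integral_fun_norm_addHaar (volume : Measure ℂ)
    (Set.indicator (Set.Iio 1) fun r => (α + 1) / Real.pi * (1 - r ^ 2) ^ α)
  rw [← integral_indicator Metric.isOpen_ball.measurableSet]
  have e : (Metric.ball (0 : ℂ) 1).indicator (discWeight α) = fun z =>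
      (Set.indicator (Set.Iio 1) fun r => (α + 1) / Real.pi * (1 - r ^ 2) ^ α) ‖z‖ := by
    funext z
    simp [Set.indicator, discWeight]
  rw [e, h]
  have e2 : ∫ y in Set.Ioi (0 : ℝ), y ^ (Module.finrank ℝ ℂ - 1) •
      (Set.indicator (Set.Iio 1) fun r => (α + 1) / Real.pi * (1 - r ^ 2) ^ α) y = (2 * Real.pi)⁻¹ := by
    have e3 : ∀ y : ℝ, y ^ (Module.finrank ℝ ℂ - 1) •
        (Set.indicator (Set.Iio 1) fun r => (α + 1) / Real.pi * (1 - r ^ 2) ^ α) y =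
        (Set.Iio 1).indicator (fun y => (2 * Real.pi)⁻¹ * (2 * (α + 1) * (y * (1 - y ^ 2) ^ α))) y := by
      intro y
      have := Real.pi_ne_zero
      by_cases hy : y < 1
      · simp [Set.indicator, hy, Complex.finrank_real_complex]; field_simp
      · simp [Set.indicator, hy]
    simp_rw [e3]
    rw [setIntegral_indicator measurableSet_Iio, Set.Ioi_inter_Iio, ← integral_Ioc_eq_integral_Ioo,
      integral_const_mul, integral_radial hα, mul_one]
  rw [e2, Measure.real, Complex.volume_ball]
  have := Real.pi_ne_zero
  simp [Complex.finrank_real_complex]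

theorem isProbabilityMeasure_discMeasure {α : ℝ} (hα : -1 < α) :
    IsProbabilityMeasure (discMeasure α) := by
  refine ⟨?_⟩
  rw [discMeasure_eq, withDensity_apply _ MeasurableSet.univ, Measure.restrict_univ,
    ← ofReal_integral_eq_lintegral_ofReal (integrableOn_discWeight hα), setIntegral_discWeight hα,
    ENNReal.ofReal_one]
  filter_upwards [ae_restrict_mem Metric.isOpen_ball.measurableSet] with z hz
  exact discWeight_nonneg hα hz

/-- The second moment `∫ |z|² dA_α = 1 / (α + 2)`. -/
theorem integral_norm_sq_discMeasure {α : ℝ} (hα : -1 < α) :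
    ∫ z : ℂ, ‖z‖ ^ 2 ∂discMeasure α = 1 / (α + 2) := by
  have h1 : (-1 : ℝ) < α + 1 := by linarith
  have h2 : α + 2 ≠ 0 := by linarith
  have h3 : α + 1 ≠ 0 := by linarith
  rw [integral_discMeasure hα]
  -- With `|z|² = 1 - (1 - |z|²)`, the second term is a multiple of the weight of exponent `α + 1`,
  -- which again has mass one.
  have e : ∫ z in Metric.ball (0 : ℂ) 1, discWeight α z • ‖z‖ ^ 2 =
      ∫ z in Metric.ball (0 : ℂ) 1, discWeight α z - (α + 1) / (α + 2) * discWeight (α + 1) z := by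
    refine setIntegral_congr_fun Metric.isOpen_ball.measurableSet fun z hz => ?_
    have h : ‖z‖ < 1 := mem_ball_zero_iff.mp hz
    have h4 : 0 < 1 - ‖z‖ ^ 2 := by nlinarith [norm_nonneg z]
    have := Real.pi_ne_zero
    simp only [discWeight, smul_eq_mul, Real.rpow_add_one h4.ne']
    field_simp
    ring
  rw [e, integral_sub (integrableOn_discWeight hα) ((integrableOn_discWeight h1).const_mul _),
    integral_const_mul, setIntegral_discWeight hα, setIntegral_discWeight h1]
  field_simp
  ring

/-! ### Rotation invariance and the mean value property. -/

theorem measurePreserving_mul_circle (α : ℝ) {c : ℂ} (hc : ‖c‖ = 1) :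
    MeasurePreserving (fun z => c * z) (discMeasure α) (discMeasure α) := by
  have h0 : MeasurePreserving (fun z : ℂ => c * z) volume volume :=
    (rotation (⟨c, mem_sphere_zero_iff_norm.mpr hc⟩ : Circle)).measurePreserving
  have h1 : (fun z : ℂ => c * z) ⁻¹' Metric.ball 0 1 = Metric.ball 0 1 := by
    ext z; simp [hc]
  have h2 := h0.restrict_preimage (s := Metric.ball (0 : ℂ) 1) Metric.isOpen_ball.measurableSet
  rw [h1] at h2
  have hm : Measurable fun z : ℂ => c * z := measurable_const_mul c
  refine ⟨hm, Measure.ext fun s hs => ?_⟩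
  rw [Measure.map_apply hm hs, discMeasure_eq, withDensity_apply _ hs, withDensity_apply _ (hm hs),
    ← lintegral_indicator hs, ← lintegral_indicator (hm hs), ← h2.lintegral_comp
      ((measurable_discWeight α).ennreal_ofReal.indicator hs)]
  refine lintegral_congr fun z => ?_
  simp only [Set.indicator, Set.mem_preimage, discWeight, norm_mul, hc, one_mul]
  rfl

section

variable {E : Type*} [NormedAddCommGroup E] [NormedSpace ℂ E] [CompleteSpace E] {α : ℝ}

/-- As `|z| < 1`, the function `ζ ↦ g (ζ z)` is holomorphic on the closed unit disc, and its circle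
average is its value at the centre. -/
theorem circle_mean_of_mem_ball {g : ℂ → E} (hg : DifferentiableOn ℂ g (Metric.ball 0 1)) {z : ℂ}
    (hz : z ∈ Metric.ball (0 : ℂ) 1) :
    ∫ θ in (0)..2 * Real.pi, g (circleMap 0 1 θ * z) = (2 * Real.pi) • g 0 := by
  have hz' : ‖z‖ < 1 := mem_ball_zero_iff.mp hz
  have h1 : DiffContOnCl ℂ (fun ζ => g (ζ * z)) (Metric.ball 0 |1|) := by
    have : DifferentiableOn ℂ (fun ζ => g (ζ * z)) (Metric.closedBall 0 |1|) := by
      refine hg.comp (differentiable_id.mul_const z).differentiableOn fun ζ hζ => ?_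
      simp only [abs_one, mem_closedBall_zero_iff] at hζ
      simp only [mem_ball_zero_iff, norm_mul]
      nlinarith [norm_nonneg z]
    refine DifferentiableOn.diffContOnCl ?_
    rwa [closure_ball _ (by simp)]
  have h2 := h1.circleAverage
  rw [Real.circleAverage, zero_mul] at h2
  rw [← h2, smul_inv_smul₀ (by positivity)]

/-- The mean value property with respect to `discMeasure`. -/
theorem integral_discMeasure_of_differentiableOn (hα : -1 < α) {g : ℂ → E}
    (hg : DifferentiableOn ℂ g (Metric.ball 0 1)) (hi : Integrable g (discMeasure α)) :
    ∫ z, g z ∂discMeasure α = g 0 := by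
  have := isProbabilityMeasure_discMeasure hα
  have h2π : (0 : ℝ) < 2 * Real.pi := by positivity
  have hn : ∀ θ : ℝ, ‖circleMap 0 1 θ‖ = 1 := fun θ => by simp
  -- The shear `(θ, z) ↦ (θ, e^{iθ} z)` preserves the product measure, which gives the integrability
  -- needed for Fubini. Integrating over `z` first yields `2π ∫ g`, over `θ` first `2π g 0`.
  have hsk : MeasurePreserving (fun p : ℝ × ℂ => (p.1, circleMap 0 1 p.1 * p.2))
      ((volume.restrict (Set.Ioc 0 (2 * Real.pi))).prod (discMeasure α))
      ((volume.restrict (Set.Ioc 0 (2 * Real.pi))).prod (discMeasure α)) := by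
    refine MeasurePreserving.skew_product (g := fun θ z => circleMap 0 1 θ * z)
      (MeasurePreserving.id _) ?_ (Filter.Eventually.of_forall fun θ =>
        (measurePreserving_mul_circle α (hn θ)).map_eq)
    exact (((continuous_circleMap 0 1).comp continuous_fst).mul continuous_snd).measurable
  have hI : Integrable (Function.uncurry fun (θ : ℝ) (z : ℂ) => g (circleMap 0 1 θ * z))
      ((volume.restrict (Set.Ioc 0 (2 * Real.pi))).prod (discMeasure α)) :=
    hsk.integrable_comp_of_integrable (hi.comp_snd _)
  have hswap := integral_integral_swap hI
  have hL : ∀ θ : ℝ, ∫ z, g (circleMap 0 1 θ * z) ∂discMeasure α = ∫ z, g z ∂discMeasure α := by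
    intro θ
    refine (measurePreserving_mul_circle α (hn θ)).integral_comp ?_ g
    exact (MeasurableEquiv.mulLeft₀ (circleMap 0 1 θ)
      (norm_ne_zero_iff.mp (by rw [hn]; exact one_ne_zero))).measurableEmbedding
  have hR : ∫ z, (∫ θ in Set.Ioc 0 (2 * Real.pi), g (circleMap 0 1 θ * z)) ∂discMeasure α =
      (2 * Real.pi) • g 0 := by
    have : ∀ᵐ z ∂discMeasure α,
        ∫ θ in Set.Ioc 0 (2 * Real.pi), g (circleMap 0 1 θ * z) = (2 * Real.pi) • g 0 := by
      filter_upwards [ae_mem_ball_discMeasure α] with z hz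
      rw [← intervalIntegral.integral_of_le h2π.le, circle_mean_of_mem_ball hg hz]
    rw [integral_congr_ae this]
    simp
  rw [hR] at hswap
  simp only [hL, integral_const, MeasurableSet.univ, measureReal_restrict_apply, Set.univ_inter,
    Real.volume_real_Ioc_of_le h2π.le, sub_zero] at hswap
  exact smul_right_injective E h2π.ne' hswap

end

/-! ### The kernel and the Möbius involution of the complex disc. -/

/-- The reproducing kernel of the complex weighted Bergman space of the unit disc. -/
noncomputable def discKernel (α : ℝ) (w z : ℂ) : ℂ := (1 - star w * z) ^ (-((α + 2 : ℝ) : ℂ))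

/-- The Möbius involution of the unit disc that exchanges `0` and `w`. -/
noncomputable def discInvolution (w u : ℂ) : ℂ := (w - u) / (1 - star w * u)

theorem re_one_sub_star_mul_pos {w u : ℂ} (hw : ‖w‖ < 1) (hu : ‖u‖ < 1) :
    0 < (1 - star w * u).re := by
  have h1 : (star w * u).re ≤ ‖star w * u‖ := Complex.re_le_norm _
  rw [norm_mul, norm_star] at h1
  have h2 : ‖w‖ * ‖u‖ < 1 := by nlinarith [norm_nonneg w, norm_nonneg u]
  simp only [Complex.sub_re, Complex.one_re]
  linarith

theorem one_sub_star_mul_ne_zero {w u : ℂ} (hw : ‖w‖ < 1) (hu : ‖u‖ < 1) : 1 - star w * u ≠ 0 :=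
  fun h => (re_one_sub_star_mul_pos hw hu).ne' (by rw [h, Complex.zero_re])

theorem one_sub_star_mul_mem_slitPlane {w u : ℂ} (hw : ‖w‖ < 1) (hu : ‖u‖ < 1) :
    1 - star w * u ∈ Complex.slitPlane :=
  Or.inl (re_one_sub_star_mul_pos hw hu)

theorem one_sub_norm_le {w u : ℂ} (hu : ‖u‖ < 1) : 1 - ‖w‖ ≤ ‖1 - star w * u‖ := by
  have h1 := norm_sub_norm_le (1 : ℂ) (star w * u)
  rw [norm_one, norm_mul, norm_star] at h1
  nlinarith [norm_nonneg w]

theorem differentiableAt_discKernel (α : ℝ) {w u : ℂ} (hw : ‖w‖ < 1) (hu : ‖u‖ < 1) :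
    DifferentiableAt ℂ (discKernel α w) u :=
  ((differentiableAt_id.const_mul _).const_sub 1).cpow_const (one_sub_star_mul_mem_slitPlane hw hu)

theorem norm_discKernel (α : ℝ) (w u : ℂ) :
    ‖discKernel α w u‖ = ‖1 - star w * u‖ ^ (-(α + 2)) := by
  rw [discKernel, ← Complex.ofReal_neg, Complex.norm_cpow_real]

theorem norm_discKernel_le {α : ℝ} (hα : -1 < α) {w u : ℂ} (hw : ‖w‖ < 1) (hu : ‖u‖ < 1) :
    ‖discKernel α w u‖ ≤ (1 - ‖w‖) ^ (-(α + 2)) := by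
  rw [norm_discKernel]
  exact Real.rpow_le_rpow_of_nonpos (by linarith) (one_sub_norm_le hu) (by linarith)

theorem measurable_discKernel (α : ℝ) (w : ℂ) : Measurable (discKernel α w) :=
  ((measurable_const_mul _).const_sub 1).pow_const _

theorem discKernel_self (α : ℝ) {w : ℂ} (hw : ‖w‖ < 1) :
    discKernel α w w = (((1 - ‖w‖ ^ 2) ^ (-(α + 2)) : ℝ) : ℂ) := by
  have h : 1 - star w * w = ((1 - ‖w‖ ^ 2 : ℝ) : ℂ) := by
    rw [Complex.star_def, Complex.conj_mul']; push_cast; rfl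
  rw [discKernel, h, ← Complex.ofReal_neg, Complex.ofReal_cpow]
  nlinarith [norm_nonneg w]

/-- This identity serves three times: the involution preserves the disc, it governs the change of
the weight, and it expresses the overlap of two normalized kernels through the pseudo-hyperbolic
distance. -/
theorem one_sub_norm_sq_discInvolution {w u : ℂ} (hw : ‖w‖ < 1) (hu : ‖u‖ < 1) :
    1 - ‖discInvolution w u‖ ^ 2 = (1 - ‖w‖ ^ 2) * (1 - ‖u‖ ^ 2) / ‖1 - star w * u‖ ^ 2 := by
  have h := one_sub_star_mul_ne_zero hw hu
  have h1 : ‖1 - star w * u‖ ^ 2 ≠ 0 := by simpa using h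
  rw [discInvolution, norm_div, div_pow, eq_div_iff h1, sub_mul, div_mul_cancel₀ _ h1]
  simp only [← Complex.normSq_eq_norm_sq, Complex.normSq_apply, Complex.sub_re, Complex.sub_im,
    Complex.mul_re, Complex.mul_im, Complex.one_re, Complex.one_im, Complex.star_def,
    Complex.conj_re, Complex.conj_im]
  ring

theorem norm_discInvolution_lt {w u : ℂ} (hw : ‖w‖ < 1) (hu : ‖u‖ < 1) :
    ‖discInvolution w u‖ < 1 := by
  have h := one_sub_norm_sq_discInvolution hw hu
  have h1 : 0 < ‖1 - star w * u‖ := norm_pos_iff.mpr (one_sub_star_mul_ne_zero hw hu)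
  have h2 : 0 < 1 - ‖w‖ ^ 2 := by nlinarith [norm_nonneg w]
  have h3 : 0 < 1 - ‖u‖ ^ 2 := by nlinarith [norm_nonneg u]
  have h4 : 0 < 1 - ‖discInvolution w u‖ ^ 2 := by rw [h]; positivity
  nlinarith [norm_nonneg (discInvolution w u)]

theorem one_sub_star_mul_discInvolution {w u : ℂ} (hw : ‖w‖ < 1) (hu : ‖u‖ < 1) :
    1 - star w * discInvolution w u = (1 - star w * w) * (1 - star w * u)⁻¹ := by
  have h := one_sub_star_mul_ne_zero hw hu
  rw [discInvolution]
  field_simp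
  ring

theorem discInvolution_discInvolution {w u : ℂ} (hw : ‖w‖ < 1) (hu : ‖u‖ < 1) :
    discInvolution w (discInvolution w u) = u := by
  have h := one_sub_star_mul_ne_zero hw hu
  have h2 := one_sub_star_mul_ne_zero hw hw
  rw [discInvolution, one_sub_star_mul_discInvolution hw hu, discInvolution,
    div_eq_iff (mul_ne_zero h2 (inv_ne_zero h)), ← div_eq_mul_inv, sub_eq_iff_eq_add, mul_div_assoc',
    ← add_div, eq_div_iff h]
  ring

theorem injOn_discInvolution {w : ℂ} (hw : ‖w‖ < 1) :
    Set.InjOn (discInvolution w) (Metric.ball 0 1) := by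
  intro u hu v hv h
  rw [mem_ball_zero_iff] at hu hv
  rw [← discInvolution_discInvolution hw hu, h, discInvolution_discInvolution hw hv]

theorem image_discInvolution {w : ℂ} (hw : ‖w‖ < 1) :
    discInvolution w '' Metric.ball 0 1 = Metric.ball 0 1 := by
  ext z
  simp only [Set.mem_image, mem_ball_zero_iff]
  constructor
  · rintro ⟨u, hu, rfl⟩
    exact norm_discInvolution_lt hw hu
  · exact fun hz => ⟨_, norm_discInvolution_lt hw hz, discInvolution_discInvolution hw hz⟩

theorem hasDerivAt_discInvolution {w u : ℂ} (hw : ‖w‖ < 1) (hu : ‖u‖ < 1) :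
    HasDerivAt (discInvolution w) (-(1 - star w * w) / (1 - star w * u) ^ 2) u := by
  have h := one_sub_star_mul_ne_zero hw hu
  have h1 : HasDerivAt (fun u : ℂ => w - u) (-1) u := (hasDerivAt_id u).const_sub w
  have h2 : HasDerivAt (fun u : ℂ => 1 - star w * u) (-star w) u := by
    simpa using ((hasDerivAt_id u).const_mul (star w)).const_sub 1
  refine (h1.div h2 h).congr_deriv ?_
  congr 1
  ring

/-- The Jacobian of a complex differentiable map. -/
theorem abs_det_restrictScalars_toSpanSingleton (c : ℂ) :
    |((ContinuousLinearMap.toSpanSingleton ℂ c).restrictScalars ℝ : ℂ →L[ℝ] ℂ).det| = ‖c‖ ^ 2 := by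
  have : ((ContinuousLinearMap.toSpanSingleton ℂ c).restrictScalars ℝ : ℂ →L[ℝ] ℂ).det =
      Algebra.norm ℝ c := by
    have h := LinearMap.det_restrictScalars (R := ℝ) (f := LinearMap.toSpanSingleton ℂ ℂ c)
    have h2 : LinearMap.det (LinearMap.toSpanSingleton ℂ ℂ c) = c := by
      simp
    rw [h2] at h
    exact h
  rw [this, Algebra.norm_complex_apply, Complex.normSq_eq_norm_sq, abs_of_nonneg (by positivity)]

/-- The base `1 - w̄ φ(u)` equals `(1 - |w|²) / (1 - w̄ u)`. The principal power splits because the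
numerator is positive and the denominator has positive real part. -/
theorem discKernel_discInvolution (α : ℝ) {w u : ℂ} (hw : ‖w‖ < 1) (hu : ‖u‖ < 1) :
    discKernel α w (discInvolution w u) =
      (((1 - ‖w‖ ^ 2) ^ (-(α + 2)) : ℝ) : ℂ) * (1 - star w * u) ^ ((α + 2 : ℝ) : ℂ) := by
  have hR : 0 < 1 - ‖w‖ ^ 2 := by nlinarith [norm_nonneg w]
  have hd := one_sub_star_mul_mem_slitPlane hw hu
  have h : 1 - star w * w = ((1 - ‖w‖ ^ 2 : ℝ) : ℂ) := by
    rw [Complex.star_def, Complex.conj_mul']; push_cast; rfl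
  have hd0 := one_sub_star_mul_ne_zero hw hu
  have hR0 : ((1 - ‖w‖ ^ 2 : ℝ) : ℂ) ≠ 0 := Complex.ofReal_ne_zero.mpr hR.ne'
  rw [discKernel, one_sub_star_mul_discInvolution hw hu, h, Complex.cpow_def_of_ne_zero
    (mul_ne_zero hR0 (inv_ne_zero hd0)), Complex.log_ofReal_mul hR (inv_ne_zero hd0),
    Complex.log_inv _ (Complex.slitPlane_arg_ne_pi hd), Complex.cpow_def_of_ne_zero hd0,
    Real.rpow_def_of_pos hR, Complex.ofReal_exp, ← Complex.exp_add]
  congr 1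
  push_cast
  ring

/-- With `d = 1 - w̄ u`, all powers of `1 - |w|²` cancel between the Jacobian, the weight and the
kernel. What remains is `|d|^(-2(α + 2))` times the conjugate of `d^(α + 2)`, that is `d^(-(α +
2))`. The conjugated kernel thus turns into a holomorphic function. -/
theorem weight_change {α : ℝ} {w u : ℂ} (hw : ‖w‖ < 1) (hu : ‖u‖ < 1) :
    ((‖-(1 - star w * w) / (1 - star w * u) ^ 2‖ ^ 2 * discWeight α (discInvolution w u) : ℝ) : ℂ) *
      star (discKernel α w (discInvolution w u)) =
      (discWeight α u : ℂ) * discKernel α w u := by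
  have hR : 0 < 1 - ‖w‖ ^ 2 := by nlinarith [norm_nonneg w]
  have hu1 : 0 < 1 - ‖u‖ ^ 2 := by nlinarith [norm_nonneg u]
  have h : 1 - star w * w = ((1 - ‖w‖ ^ 2 : ℝ) : ℂ) := by
    rw [Complex.star_def, Complex.conj_mul']; push_cast; rfl
  have hd0 := one_sub_star_mul_ne_zero hw hu
  rw [discKernel_discInvolution α hw hu, discWeight, one_sub_norm_sq_discInvolution hw hu, discWeight,
    discKernel, h, Complex.cpow_neg]
  generalize 1 - star w * u = d at hd0 ⊢
  have hn : 0 < ‖d‖ := norm_pos_iff.mpr hd0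
  have hc0 : d ^ ((α + 2 : ℝ) : ℂ) ≠ 0 := by simp [Complex.cpow_eq_zero_iff, hd0]
  have hcn : star (d ^ ((α + 2 : ℝ) : ℂ)) * d ^ ((α + 2 : ℝ) : ℂ) =
      (((‖d‖ ^ 2) ^ (α + 2) : ℝ) : ℂ) := by
    rw [Complex.star_def, Complex.conj_mul', Complex.norm_cpow_real, ← Complex.ofReal_pow,
      Real.rpow_pow_comm hn.le]
  rw [eq_mul_inv_iff_mul_eq₀ hc0, star_mul', mul_assoc, mul_assoc, hcn]
  simp only [Complex.star_def, Complex.conj_ofReal, ← Complex.ofReal_mul]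
  congr 1
  rw [norm_div, norm_neg, Complex.norm_real, Real.norm_of_nonneg hR.le, norm_pow,
    Real.div_rpow (by positivity) (by positivity), Real.mul_rpow hR.le hu1.le, Real.rpow_neg hR.le,
    Real.rpow_add hR, Real.rpow_add (by positivity : 0 < ‖d‖ ^ 2), Real.rpow_two, Real.rpow_two]
  have h1 : (1 - ‖w‖ ^ 2) ^ α ≠ 0 := (Real.rpow_pos_of_pos hR _).ne'
  have h2 : (‖d‖ ^ 2) ^ α ≠ 0 := (Real.rpow_pos_of_pos (by positivity) _).ne'
  have := Real.pi_ne_zero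
  field_simp

theorem ae_norm_discKernel_le {α : ℝ} (hα : -1 < α) {w : ℂ} (hw : ‖w‖ < 1) :
    ∀ᵐ z ∂discMeasure α, ‖discKernel α w z‖ ≤ (1 - ‖w‖) ^ (-(α + 2)) := by
  filter_upwards [ae_mem_ball_discMeasure α] with z hz
  exact norm_discKernel_le hα hw (mem_ball_zero_iff.mp hz)

section

variable {E : Type*} [NormedAddCommGroup E]

/-- After the substitution `z = φ(u)` the integrand against the measure is the holomorphic function
`K_w(u) f(φ(u))`, and the mean value property gives `K_w(0) f(φ(0)) = f(w)`. -/
theorem integral_star_discKernel_smul_aux [NormedSpace ℂ E] [CompleteSpace E] {α : ℝ} (hα : -1 < α)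
    {w : ℂ} (hw : ‖w‖ < 1) {f : ℂ → E} (hf : DifferentiableOn ℂ f (Metric.ball 0 1))
    (hi : Integrable f (discMeasure α)) :
    ∫ z, star (discKernel α w z) • f z ∂discMeasure α = f w := by
  have hs : MeasurableSet (Metric.ball (0 : ℂ) 1) := Metric.isOpen_ball.measurableSet
  have hiK : Integrable (fun z => star (discKernel α w z) • f z) (discMeasure α) := by
    refine hi.bdd_smul ((1 - ‖w‖) ^ (-(α + 2))) ?_ ?_
    · exact (continuous_star.measurable.comp (measurable_discKernel α w)).aestronglyMeasurable
    · simpa only [norm_star] using ae_norm_discKernel_le hα hw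
  have hd : ∀ u ∈ Metric.ball (0 : ℂ) 1, HasFDerivWithinAt (discInvolution w)
      ((ContinuousLinearMap.toSpanSingleton ℂ
        (-(1 - star w * w) / (1 - star w * u) ^ 2)).restrictScalars ℝ) (Metric.ball 0 1) u :=
    fun u hu => ((hasDerivAt_discInvolution hw
      (mem_ball_zero_iff.mp hu)).hasFDerivAt.restrictScalars ℝ).hasFDerivWithinAt
  have hpt : ∀ u ∈ Metric.ball (0 : ℂ) 1, |((ContinuousLinearMap.toSpanSingleton ℂ
        (-(1 - star w * w) / (1 - star w * u) ^ 2)).restrictScalars ℝ : ℂ →L[ℝ] ℂ).det| •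
      (discWeight α (discInvolution w u) • (star (discKernel α w (discInvolution w u)) •
        f (discInvolution w u))) =
      discWeight α u • (discKernel α w u • f (discInvolution w u)) := by
    intro u hu
    rw [abs_det_restrictScalars_toSpanSingleton, smul_smul, ← Complex.coe_smul,
      ← Complex.coe_smul (discWeight α u), smul_smul, smul_smul, weight_change hw (mem_ball_zero_iff.mp hu)]
  have hi2 := (integrable_discMeasure_iff hα).mp hiK
  have hint := integral_image_eq_integral_abs_det_fderiv_smul volume hs hd (injOn_discInvolution hw)
    fun z => discWeight α z • (star (discKernel α w z) • f z)
  have hii := integrableOn_image_iff_integrableOn_abs_det_fderiv_smul volume hs hd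
    (injOn_discInvolution hw) fun z => discWeight α z • (star (discKernel α w z) • f z)
  rw [image_discInvolution hw, setIntegral_congr_fun hs hpt] at hint
  rw [image_discInvolution hw, integrableOn_congr_fun hpt hs] at hii
  rw [integral_discMeasure hα, hint, ← integral_discMeasure hα,
    integral_discMeasure_of_differentiableOn hα _ ((integrable_discMeasure_iff hα).mpr (hii.mp hi2))]
  · simp [discKernel, discInvolution]
  · refine DifferentiableOn.smul (fun u hu => (differentiableAt_discKernel α hw
      (mem_ball_zero_iff.mp hu)).differentiableWithinAt) (hf.comp (fun u hu =>
        (hasDerivAt_discInvolution hw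
          (mem_ball_zero_iff.mp hu)).differentiableAt.differentiableWithinAt) fun u hu => ?_)
    exact mem_ball_zero_iff.mpr (norm_discInvolution_lt hw (mem_ball_zero_iff.mp hu))

/-- The reproducing property of `discKernel` for vector valued holomorphic functions. -/
theorem integral_star_discKernel_smul [iR : NormedSpace ℝ E] [NormedSpace ℂ E] [IsScalarTower ℝ ℂ E]
    [CompleteSpace E] {α : ℝ} (hα : -1 < α)
    {w : ℂ} (hw : ‖w‖ < 1) {f : ℂ → E} (hf : DifferentiableOn ℂ f (Metric.ball 0 1))
    (hi : Integrable f (discMeasure α)) :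
    ∫ z, star (discKernel α w z) • f z ∂discMeasure α = f w := by
  -- The quaternions bring their own real structure, and the integral depends on it. The scalar
  -- tower forces it to be the one induced from `ℂ`.
  have h : iR = NormedSpace.complexToReal := by
    have hm : iR.toModule = NormedSpace.complexToReal.toModule := by
      refine Module.ext' _ _ fun r x => ?_
      have h1 := smul_assoc r (1 : ℂ) x
      rw [one_smul] at h1
      rw [← h1, Complex.real_smul, mul_one]
      rfl
    cases iR
    congr
  subst h
  exact integral_star_discKernel_smul_aux hα hw hf hi

end

/-! ### From the complex disc to a slice of the quaternionic ball. -/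

/-- The embedding of `ℂ` onto the slice plane `ℂ_i`. -/
noncomputable def sliceEmb (i : ImagUnit) : ℂ →ₐ[ℝ] ℍ[ℝ] := Complex.liftAux i.1 (unit_mul_self i)

theorem sliceEmb_apply (i : ImagUnit) (z : ℂ) : sliceEmb i z = pt i.1 z.re z.im := by
  rw [sliceEmb, Complex.liftAux_apply, pt, Quaternion.mul_coe_eq_smul]
  rfl

theorem norm_sliceEmb (i : ImagUnit) (z : ℂ) : ‖sliceEmb i z‖ = ‖z‖ := by
  rw [← sq_eq_sq₀ (norm_nonneg _) (norm_nonneg _), sliceEmb_apply, norm_pt_sq,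
    ← Complex.normSq_eq_norm_sq, Complex.normSq_apply]
  ring

theorem star_unit (i : ImagUnit) : star i.1 = -i.1 := Quaternion.star_eq_neg.mpr i.2.1

theorem star_sliceEmb (i : ImagUnit) (z : ℂ) : star (sliceEmb i z) = sliceEmb i (star z) := by
  simp [sliceEmb, Complex.liftAux_apply, star_unit]

theorem sliceEmb_I (i : ImagUnit) : sliceEmb i Complex.I = i.1 := by
  simp [sliceEmb]

theorem sliceEmb_ofReal (i : ImagUnit) (r : ℝ) : sliceEmb i r = (r : ℍ[ℝ]) := by
  simp [sliceEmb]

/-- The complex structure on the quaternions given by left multiplication by elements of `ℂ_i`. -/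
noncomputable abbrev sliceNormedSpace (i : ImagUnit) : NormedSpace ℂ ℍ[ℝ] where
  toModule := Module.compHom ℍ[ℝ] (sliceEmb i).toRingHom
  norm_smul_le c q := by
    change ‖sliceEmb i c * q‖ ≤ _
    rw [norm_mul, norm_sliceEmb]

/-- The reproducing property of `discKernel` for quaternion valued functions satisfying
`∂f/∂x + i ∂f/∂y = 0`. -/
theorem integral_star_sliceEmb_discKernel_mul (i : ImagUnit) {α : ℝ} (hα : -1 < α)
    {w : ℂ} (hw : ‖w‖ < 1) {f : ℂ → ℍ[ℝ]} {f' : ℂ → ℂ →L[ℝ] ℍ[ℝ]}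
    (hf : ∀ z ∈ Metric.ball (0 : ℂ) 1, HasFDerivAt f (f' z) z ∧ f' z Complex.I = i.1 * f' z 1)
    (hi : Integrable f (discMeasure α)) :
    ∫ z, star (sliceEmb i (discKernel α w z)) * f z ∂discMeasure α = f w := by
  let := sliceNormedSpace i
  have : IsScalarTower ℝ ℂ ℍ[ℝ] := ⟨fun r c q => by
    change sliceEmb i (r • c) * q = r • (sliceEmb i c * q)
    rw [map_smul, smul_mul_assoc]⟩
  -- For the complex structure by left multiplication, the Cauchy-Riemann equation says exactly that
  -- the real derivative is complex linear.
  have hd : DifferentiableOn ℂ f (Metric.ball 0 1) := by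
    intro z hz
    obtain ⟨h1, h2⟩ := hf z hz
    refine DifferentiableAt.differentiableWithinAt
      ⟨ContinuousLinearMap.toSpanSingleton ℂ (f' z 1), hasFDerivAt_of_restrictScalars ℝ h1 ?_⟩
    ext1 v
    change sliceEmb i v * f' z 1 = f' z v
    have e : v = v.re • (1 : ℂ) + v.im • Complex.I := by
      simp
    conv_rhs => rw [e, map_add, map_smul, map_smul, h2]
    rw [sliceEmb_apply, pt, add_mul, Quaternion.coe_mul_eq_smul, Quaternion.mul_coe_eq_smul,
      smul_mul_assoc]
  have h := integral_star_discKernel_smul hα hw hd hi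
  rw [← h]
  congr 1
  funext z
  rw [star_sliceEmb]
  rfl

theorem mem_ball_iff_pt (i : ImagUnit) (z : ℂ) :
    pt i.1 z.re z.im ∈ unitBall ↔ z ∈ Metric.ball (0 : ℂ) 1 := by
  rw [← sliceEmb_apply, unitBall, mem_ball_zero_iff, mem_ball_zero_iff, norm_sliceEmb]

theorem exists_eq_pt (q : ℍ[ℝ]) (i : ImagUnit) : ∃ (k : ImagUnit) (x y : ℝ), q = pt k.1 x y := by
  by_cases h : q.im = 0
  · refine ⟨i, q.re, 0, ?_⟩
    conv_lhs => rw [← Quaternion.re_add_im q, h]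
    simp [pt]
  · have hn : ‖q.im‖ ≠ 0 := norm_ne_zero_iff.mpr h
    refine ⟨⟨unitOf q, ?_, ?_⟩, q.re, ‖q.im‖, ?_⟩
    · rw [unitOf, Quaternion.mul_coe_eq_smul]; simp
    · rw [unitOf, norm_mul, Quaternion.norm_coe, norm_inv, norm_norm, mul_inv_cancel₀ hn]
    · rw [pt, unitOf_mul_norm, Quaternion.re_add_im]

/-- The values at `z` and `z̄` are `a + i b` and `a - i b`. They determine the stem functions, hence
`f` on every slice. -/
theorem eq_zero_of_restr_eq_zero {α : ℝ} {i : ImagUnit} {f : bergmanSpace α i}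
    (h : ∀ z ∈ Metric.ball (0 : ℂ) 1, restr i f z = 0) : f = 0 := by
  obtain ⟨hf0, ⟨-, a, b, hab⟩, -⟩ := f.2
  have key : ∀ x y : ℝ, x ^ 2 + y ^ 2 < 1 → a (x, y) = 0 ∧ b (x, y) = 0 := by
    intro x y hxy
    have hxy' : x ^ 2 + (-y) ^ 2 < 1 := by simpa using hxy
    have h1 := h ⟨x, y⟩ ((mem_ball_iff_pt i _).mp ((pt_mem_unitBall i x y).mpr hxy))
    have h2 := h ⟨x, -y⟩ ((mem_ball_iff_pt i _).mp ((pt_mem_unitBall i x (-y)).mpr hxy'))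
    obtain ⟨e1, e2, e3, -⟩ := hab i x y ((pt_mem_unitBall i x y).mpr hxy)
    obtain ⟨e4, -⟩ := hab i x (-y) ((pt_mem_unitBall i x (-y)).mpr hxy')
    simp only [restr] at h1 h2
    rw [e1] at h1
    rw [e4, e2, e3, mul_neg] at h2
    have h3 : a (x, y) = -(i.1 * b (x, y)) := eq_neg_of_add_eq_zero_left h1
    have h4 : i.1 * b (x, y) = 0 := by
      refine eq_zero_of_eq_neg ?_
      rw [h3] at h2
      have := eq_neg_of_add_eq_zero_left h2
      simpa using this.symm
    have hi0 : i.1 ≠ 0 := fun h0 => by simpa [h0] using i.2.2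
    refine ⟨by rw [h3, h4, neg_zero], (mul_eq_zero.mp h4).resolve_left hi0⟩
  ext1
  funext q
  by_cases hq : q ∈ unitBall
  · obtain ⟨k, x, y, rfl⟩ := exists_eq_pt q i
    obtain ⟨h1, h2⟩ := key x y ((pt_mem_unitBall k x y).mp hq)
    change f.1 _ = 0
    rw [(hab k x y hq).1, h1, h2, mul_zero, add_zero]
  · exact hf0 q hq

theorem restr_eq_zero_of_notMem {α : ℝ} {i : ImagUnit} (f : bergmanSpace α i) {z : ℂ}
    (hz : z ∉ Metric.ball (0 : ℂ) 1) : restr i f z = 0 :=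
  f.2.1 _ fun h => hz ((mem_ball_iff_pt i z).mp h)

/-- Restrictions to `ℂ_i` satisfy the Cauchy-Riemann equation `∂f/∂x + i ∂f/∂y = 0`. -/
theorem exists_hasFDerivAt_restr {α : ℝ} {i : ImagUnit} (f : bergmanSpace α i) :
    ∃ f' : ℂ → ℂ →L[ℝ] ℍ[ℝ], ∀ z ∈ Metric.ball (0 : ℂ) 1,
      HasFDerivAt (restr i f) (f' z) z ∧ f' z Complex.I = i.1 * f' z 1 := by
  obtain ⟨f, hf0, ⟨-, a, b, hab⟩, -⟩ := f
  let e : ℂ →L[ℝ] ℝ × ℝ := Complex.reCLM.prod Complex.imCLM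
  refine ⟨fun z => (fderiv ℝ a (z.re, z.im)).comp e +
    i.1 • (fderiv ℝ b (z.re, z.im)).comp e, fun z hz => ?_⟩
  obtain ⟨-, -, -, h4, h5, h6, h7⟩ := hab i z.re z.im ((mem_ball_iff_pt i z).mpr hz)
  constructor
  · have ha := h4.hasFDerivAt.comp z (f := fun z : ℂ => (z.re, z.im)) e.hasFDerivAt
    have hb := h5.hasFDerivAt.comp z (f := fun z : ℂ => (z.re, z.im)) e.hasFDerivAt
    refine (ha.add (hb.const_mul i.1)).congr_of_eventuallyEq ?_
    filter_upwards [Metric.isOpen_ball.mem_nhds hz] with u hu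
    exact (hab i u.re u.im ((mem_ball_iff_pt i u).mpr hu)).1
  · simp only [e, _root_.add_apply, _root_.smul_apply, ContinuousLinearMap.comp_apply,
      ContinuousLinearMap.prod_apply, Complex.reCLM_apply, Complex.imCLM_apply, Complex.I_re,
      Complex.I_im, Complex.one_re, Complex.one_im, smul_eq_mul, h6, h7, mul_add, mul_neg,
      ← mul_assoc, unit_mul_self]
    simp [add_comm]

theorem integrable_restr {α : ℝ} (hα : -1 < α) {i : ImagUnit} (f : bergmanSpace α i) :
    Integrable (restr i f) (discMeasure α) :=
  have := isProbabilityMeasure_discMeasure hα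
  f.2.2.2.integrable one_le_two

theorem integral_star_discKernel_mul_restr {α : ℝ} (hα : -1 < α) {i : ImagUnit}
    (f : bergmanSpace α i) {w : ℂ} (hw : ‖w‖ < 1) :
    ∫ z, star (sliceEmb i (discKernel α w z)) * restr i f z ∂discMeasure α = restr i f w := by
  obtain ⟨f', hf'⟩ := exists_hasFDerivAt_restr f
  exact integral_star_sliceEmb_discKernel_mul i hα hw hf' (integrable_restr hα f)

/-! ### Slice hyperholomorphic extension of holomorphic functions. -/

/-- For `y < 0` the imaginary unit of the point is `-k`, and parity absorbs the sign. For `y = 0`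
the default value of `unitOf` is harmless because `b` vanishes by oddness. -/
theorem stem_pt (k : ImagUnit) {a b : ℝ × ℝ → ℍ[ℝ]} {x y : ℝ} (ha : a (x, -y) = a (x, y))
    (hb : b (x, -y) = -b (x, y)) :
    a ((pt k.1 x y).re, ‖(pt k.1 x y).im‖) +
      unitOf (pt k.1 x y) * b ((pt k.1 x y).re, ‖(pt k.1 x y).im‖) = a (x, y) + k.1 * b (x, y) := by
  rw [unitOf, norm_pt_im, pt_re, pt_im]
  rcases lt_trichotomy y 0 with h | h | h
  · have h1 : y • k.1 * ((|y|⁻¹ : ℝ) : ℍ[ℝ]) = -k.1 := by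
      rw [Quaternion.mul_coe_eq_smul, smul_smul, abs_of_neg h]
      have : (-y)⁻¹ * y = -1 := by rw [inv_neg, neg_mul, inv_mul_cancel₀ h.ne]
      rw [this]; simp
    rw [h1, abs_of_neg h, ha, hb]; simp
  · subst h
    rw [neg_zero] at hb
    simp [eq_zero_of_eq_neg hb]
  · have h1 : y • k.1 * ((|y|⁻¹ : ℝ) : ℍ[ℝ]) = k.1 := by
      rw [Quaternion.mul_coe_eq_smul, smul_smul, abs_of_pos h, inv_mul_cancel₀ h.ne', one_smul]
    rw [h1, abs_of_pos h]

/-- The map `(x, y) ↦ x + i y` as a continuous linear map. -/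
noncomputable def toComplexL : ℝ × ℝ →L[ℝ] ℂ :=
  Complex.equivRealProdCLM.symm.toContinuousLinearMap

theorem toComplexL_apply (p : ℝ × ℝ) : toComplexL p = ⟨p.1, p.2⟩ := rfl

/-- `sliceEmb` as a continuous real linear map. -/
noncomputable def sliceEmbL (i : ImagUnit) : ℂ →L[ℝ] ℍ[ℝ] :=
  LinearMap.toContinuousLinearMap (sliceEmb i).toLinearMap

/-- The even part of the stem function of `h`. -/
noncomputable def stemA (i : ImagUnit) (h : ℂ → ℂ) (p : ℝ × ℝ) : ℍ[ℝ] :=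
  sliceEmbL i ((1 / 2 : ℂ) * (h (toComplexL p) + h (Complex.conjCLE (toComplexL p))))

/-- The odd part of the stem function of `h`. -/
noncomputable def stemB (i : ImagUnit) (h : ℂ → ℂ) (p : ℝ × ℝ) : ℍ[ℝ] :=
  sliceEmbL i ((-Complex.I / 2) * (h (toComplexL p) - h (Complex.conjCLE (toComplexL p))))

theorem stemA_neg (i : ImagUnit) (h : ℂ → ℂ) (x y : ℝ) : stemA i h (x, -y) = stemA i h (x, y) := by
  have e1 : toComplexL (x, -y) = Complex.conjCLE (toComplexL (x, y)) := by
    apply Complex.ext <;> simp [toComplexL_apply]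
  rw [stemA, stemA, e1]
  simp [add_comm]

theorem stemB_neg (i : ImagUnit) (h : ℂ → ℂ) (x y : ℝ) :
    stemB i h (x, -y) = -stemB i h (x, y) := by
  have e1 : toComplexL (x, -y) = Complex.conjCLE (toComplexL (x, y)) := by
    apply Complex.ext <;> simp [toComplexL_apply]
  rw [stemB, stemB, e1, ← map_neg, ← mul_neg, neg_sub]
  simp

/-- The `y`-derivatives of `h(z)` and `h(z̄)` are `i h'(z)` and `-i h'(z̄)`. The factor `-i/2` in
`stemB` converts the sum into the difference and back. -/
theorem stem_hasFDerivAt (i : ImagUnit) {h : ℂ → ℂ} (hh : DifferentiableOn ℂ h (Metric.ball 0 1))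
    {x y : ℝ} (hxy : x ^ 2 + y ^ 2 < 1) :
    DifferentiableAt ℝ (stemA i h) (x, y) ∧ DifferentiableAt ℝ (stemB i h) (x, y) ∧
    fderiv ℝ (stemA i h) (x, y) (1, 0) = fderiv ℝ (stemB i h) (x, y) (0, 1) ∧
    fderiv ℝ (stemB i h) (x, y) (1, 0) = -fderiv ℝ (stemA i h) (x, y) (0, 1) := by
  have hz : toComplexL (x, y) ∈ Metric.ball (0 : ℂ) 1 := by
    rw [← mem_ball_iff_pt i, pt_mem_unitBall]; exact hxy
  have hz' : Complex.conjCLE (toComplexL (x, y)) ∈ Metric.ball (0 : ℂ) 1 := by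
    rw [← mem_ball_iff_pt i, pt_mem_unitBall]; simpa [toComplexL_apply] using hxy
  have d1 := (hh.differentiableAt (Metric.isOpen_ball.mem_nhds hz)).hasDerivAt
  have d2 := (hh.differentiableAt (Metric.isOpen_ball.mem_nhds hz')).hasDerivAt
  have f1 := (d1.hasFDerivAt.restrictScalars ℝ).comp (x, y) toComplexL.hasFDerivAt
  have f2 := (d2.hasFDerivAt.restrictScalars ℝ).comp (x, y)
    (f := fun p => Complex.conjCLE (toComplexL p))
    (Complex.conjCLE.toContinuousLinearMap.comp toComplexL).hasFDerivAt
  have hA := (sliceEmbL i).hasFDerivAt.comp (x, y) ((f1.add f2).const_mul (1 / 2 : ℂ))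
  have hB := (sliceEmbL i).hasFDerivAt.comp (x, y) ((f1.sub f2).const_mul (-Complex.I / 2 : ℂ))
  have hA' : HasFDerivAt (stemA i h) _ (x, y) := hA
  have hB' : HasFDerivAt (stemB i h) _ (x, y) := hB
  have t1 : toComplexL (1, 0) = 1 := rfl
  have t2 : toComplexL (0, 1) = Complex.I := rfl
  refine ⟨hA'.differentiableAt, hB'.differentiableAt, ?_, ?_⟩
  · rw [hA'.fderiv, hB'.fderiv]
    simp only [ContinuousLinearMap.comp_apply, _root_.add_apply, _root_.sub_apply, _root_.smul_apply, t1, t2]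
    congr 1
    simp
    ring_nf
    simp
    ring
  · rw [hA'.fderiv, hB'.fderiv]
    simp only [ContinuousLinearMap.comp_apply, _root_.add_apply, _root_.sub_apply, _root_.smul_apply, t1, t2]
    rw [← map_neg]
    congr 1
    simp
    ring

open scoped Classical in
/-- The left slice hyperholomorphic extension of a holomorphic function on the disc. -/
noncomputable def holExt (i : ImagUnit) (h : ℂ → ℂ) (x : ℍ[ℝ]) : ℍ[ℝ] :=
  if x ∈ unitBall then stemA i h (x.re, ‖x.im‖) + unitOf x * stemB i h (x.re, ‖x.im‖) else 0

theorem holExt_pt (i k : ImagUnit) (h : ℂ → ℂ) {x y : ℝ} (hxy : pt k.1 x y ∈ unitBall) :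
    holExt i h (pt k.1 x y) = stemA i h (x, y) + k.1 * stemB i h (x, y) := by
  rw [holExt, if_pos hxy, stem_pt k (stemA_neg i h x y) (stemB_neg i h x y)]

theorem restr_holExt (i : ImagUnit) (h : ℂ → ℂ) {z : ℂ} (hz : z ∈ Metric.ball (0 : ℂ) 1) :
    restr i (holExt i h) z = sliceEmb i (h z) := by
  rw [restr, holExt_pt i i h ((mem_ball_iff_pt i z).mpr hz)]
  change sliceEmb i _ + i.1 * sliceEmb i _ = _
  rw [← sliceEmb_I, ← map_mul, ← map_add]
  have : toComplexL (z.re, z.im) = z := rfl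
  rw [this]
  congr 1
  ring_nf
  simp
  ring

theorem holExt_mem {α : ℝ} (i : ImagUnit) {h : ℂ → ℂ} (hh : DifferentiableOn ℂ h (Metric.ball 0 1))
    (hL : MemLp h 2 (discMeasure α)) : holExt i h ∈ bergmanSpace α i := by
  refine ⟨fun x hx => by rw [holExt, if_neg hx], ⟨?_, stemA i h, stemB i h, ?_⟩, ?_⟩
  · intro q hq
    refine ((differentiableAt_stem (a := stemA i h) (b := stemB i h)
      (fun x y hxy => ?_) hq).congr_of_eventuallyEq ?_).differentiableWithinAt
    · obtain ⟨h1, h2, -⟩ := stem_hasFDerivAt i hh hxy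
      exact ⟨stemA_neg i h x y, stemB_neg i h x y, h1, h2⟩
    · filter_upwards [Metric.isOpen_ball.mem_nhds hq] with x hx
      rw [holExt, if_pos (show x ∈ unitBall from hx)]
  · intro k x y hxy
    exact ⟨holExt_pt i k h hxy, stemA_neg i h x y, stemB_neg i h x y,
      stem_hasFDerivAt i hh ((pt_mem_unitBall k x y).mp hxy)⟩
  · have e : restr i (holExt i h) =ᵐ[discMeasure α] fun z => sliceEmbL i (h z) := by
      filter_upwards [ae_mem_ball_discMeasure α] with z hz
      exact restr_holExt i h hz
    refine MemLp.ae_eq e.symm ?_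
    exact (sliceEmbL i).comp_memLp' hL

/-! ### The scalar product and the operator `J`. -/

section

variable {α : ℝ} {i : ImagUnit}

theorem restr_add (f g : bergmanSpace α i) (z : ℂ) :
    restr i ((f + g : bergmanSpace α i) : ℍ[ℝ] → ℍ[ℝ]) z = restr i f z + restr i g z := rfl

theorem restr_sub (f g : bergmanSpace α i) (z : ℂ) :
    restr i ((f - g : bergmanSpace α i) : ℍ[ℝ] → ℍ[ℝ]) z = restr i f z - restr i g z := rfl

theorem restr_op_smul (c : ℍ[ℝ]) (f : bergmanSpace α i) (z : ℂ) :
    restr i ((op c • f : bergmanSpace α i) : ℍ[ℝ] → ℍ[ℝ]) z = restr i f z * c := rfl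

theorem integrable_bInner (f g : bergmanSpace α i) :
    Integrable (fun z => star (restr i f z) * restr i g z) (discMeasure α) :=
  (f.2.2.2.star).integrable_mul g.2.2.2

theorem bInner_add_right (f g h : bergmanSpace α i) :
    bInner f (g + h) = bInner f g + bInner f h := by
  simp only [bInner, restr_add, mul_add]
  exact integral_add (integrable_bInner f g) (integrable_bInner f h)

theorem bInner_sub_right (f g h : bergmanSpace α i) :
    bInner f (g - h) = bInner f g - bInner f h := by
  simp only [bInner, restr_sub, mul_sub]
  exact integral_sub (integrable_bInner f g) (integrable_bInner f h)

theorem bInner_smul_right (f g : bergmanSpace α i) (c : ℍ[ℝ]) :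
    bInner f (op c • g) = bInner f g * c := by
  simp only [bInner, restr_op_smul, ← mul_assoc]
  exact ((ContinuousLinearMap.mul ℝ ℍ[ℝ]).flip c).integral_comp_comm (integrable_bInner f g)

theorem star_bInner (f g : bergmanSpace α i) : star (bInner f g) = bInner g f := by
  have h := (LinearMap.toContinuousLinearMap
    ({ toFun := star, map_add' := star_add, map_smul' := Quaternion.star_smul } :
      ℍ[ℝ] →ₗ[ℝ] ℍ[ℝ])).integral_comp_comm (integrable_bInner f g)
  simpa [bInner] using h.symm

theorem bInner_add_left (f g h : bergmanSpace α i) :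
    bInner (f + g) h = bInner f h + bInner g h := by
  rw [← star_bInner, bInner_add_right, star_add, star_bInner, star_bInner]

theorem bInner_sub_left (f g h : bergmanSpace α i) :
    bInner (f - g) h = bInner f h - bInner g h := by
  rw [← star_bInner, bInner_sub_right, star_sub, star_bInner, star_bInner]

theorem bInner_smul_left (f g : bergmanSpace α i) (c : ℍ[ℝ]) :
    bInner (op c • f) g = star c * bInner f g := by
  rw [← star_bInner, bInner_smul_right, star_mul, star_bInner]

theorem bNorm_nonneg (f : bergmanSpace α i) : 0 ≤ bNorm f := Real.sqrt_nonneg _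

theorem bNorm_sq (f : bergmanSpace α i) : bNorm f ^ 2 = ∫ z, ‖restr i f z‖ ^ 2 ∂discMeasure α :=
  Real.sq_sqrt (integral_nonneg fun _ => by positivity)

theorem bInner_self (f : bergmanSpace α i) : bInner f f = ((bNorm f ^ 2 : ℝ) : ℍ[ℝ]) := by
  rw [bNorm_sq, bInner]
  simp only [Quaternion.star_mul_self, Quaternion.normSq_eq_norm_mul_self, ← sq]
  have h := (Algebra.linearMap ℝ ℍ[ℝ]).toContinuousLinearMap.integral_comp_comm
    (f.2.2.2.integrable_norm_pow two_ne_zero)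
  simpa using h

theorem norm_bInner_le (f g : bergmanSpace α i) : ‖bInner f g‖ ≤ bNorm f * bNorm g := by
  refine (norm_integral_le_integral_norm _).trans ?_
  simp only [norm_mul, norm_star]
  have h := integral_mul_norm_le_Lp_mul_Lq (μ := discMeasure α) (p := 2) (q := 2)
    Real.HolderConjugate.two_two (f := restr i f) (g := restr i g)
    (by simpa using f.2.2.2) (by simpa using g.2.2.2)
  simp only [Real.rpow_two, ← Real.sqrt_eq_rpow] at h
  exact h

theorem bNorm_smul (f : bergmanSpace α i) (c : ℍ[ℝ]) : bNorm (op c • f) = bNorm f * ‖c‖ := by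
  rw [← sq_eq_sq₀ (bNorm_nonneg _) (mul_nonneg (bNorm_nonneg _) (norm_nonneg _)), mul_pow, bNorm_sq,
    bNorm_sq, ← integral_mul_const]
  simp only [restr_op_smul, norm_mul, mul_pow]

theorem restr_opJ (f : bergmanSpace α i) (z : ℂ) :
    restr i (opJ α i f) z = i.1 * restr i f z := by
  obtain ⟨hf0, ⟨-, a, b, hab⟩, -⟩ := f.2
  have H : ∀ (i : ImagUnit) (x₀ x₁ : ℝ), pt i.1 x₀ x₁ ∈ unitBall →
      f.1 (pt i.1 x₀ x₁) = a (x₀, x₁) + i.1 * b (x₀, x₁) ∧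
      a (x₀, -x₁) = a (x₀, x₁) ∧ b (x₀, -x₁) = -b (x₀, x₁) := fun i x y h =>
    ⟨(hab i x y h).1, (hab i x y h).2.1, (hab i x y h).2.2.1⟩
  by_cases hz : z ∈ Metric.ball (0 : ℂ) 1
  · have hz' := (mem_ball_iff_pt i z).mpr hz
    change extL i (fun z => i.1 * f.1 z) (pt i.1 z.re z.im) = i.1 * f.1 (pt i.1 z.re z.im)
    rw [extL_pt i i hz' H, (H i _ _ hz').1, mul_add]
  · rw [restr_eq_zero_of_notMem _ hz, restr_eq_zero_of_notMem _ hz, mul_zero]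

theorem ext_restr {f g : bergmanSpace α i}
    (h : ∀ z ∈ Metric.ball (0 : ℂ) 1, restr i f z = restr i g z) : f = g :=
  sub_eq_zero.mp (eq_zero_of_restr_eq_zero fun z hz => by rw [restr_sub, h z hz, sub_self])

/-- An element of the Bergman space is `ℂ_i`-valued on `𝔻_i`. -/
def IsSliceValued (f : bergmanSpace α i) : Prop :=
  ∃ h : ℂ → ℂ, ∀ z ∈ Metric.ball (0 : ℂ) 1, restr i f z = sliceEmb i (h z)

theorem unit_mul_sliceEmb (i : ImagUnit) (z : ℂ) : i.1 * sliceEmb i z = sliceEmb i z * i.1 := by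
  rw [← sliceEmb_I, ← map_mul, ← map_mul, mul_comm]

/-- Left and right multiplication by `i` agree on `ℂ_i`. Thus `J` acts on such `f` as a right
scalar, which passes through every right linear operator. -/
theorem opJ_of_isSliceValued {f : bergmanSpace α i} (hf : IsSliceValued f) :
    opJ α i f = op i.1 • f := by
  obtain ⟨h, hh⟩ := hf
  refine ext_restr fun z hz => ?_
  rw [restr_opJ, restr_op_smul, hh z hz, unit_mul_sliceEmb]

theorem bInner_opJ_right {f : bergmanSpace α i} (hf : IsSliceValued f) (g : bergmanSpace α i) :
    bInner f (opJ α i g) = i.1 * bInner f g := by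
  obtain ⟨h, hh⟩ := hf
  have e := (ContinuousLinearMap.mul ℝ ℍ[ℝ] i.1).integral_comp_comm (integrable_bInner f g)
  refine Eq.trans (integral_congr_ae ?_) e
  filter_upwards [ae_mem_ball_discMeasure α] with z hz
  simp only [restr_opJ, hh z hz, ContinuousLinearMap.mul_apply', star_sliceEmb, ← mul_assoc,
    unit_mul_sliceEmb]

end

/-! ### The reproducing kernel of the slice Bergman space. -/

/-- The extension of `discKernel` lies in the Bergman space. -/
theorem holExt_discKernel_mem {α : ℝ} (hα : -1 < α) (i : ImagUnit) {w : ℂ} (hw : ‖w‖ < 1) :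
    holExt i (discKernel α w) ∈ bergmanSpace α i := by
  have := isProbabilityMeasure_discMeasure hα
  exact holExt_mem i (fun u hu => (differentiableAt_discKernel α hw
    (mem_ball_zero_iff.mp hu)).differentiableWithinAt)
    (MemLp.of_bound (measurable_discKernel α w).aestronglyMeasurable _ (ae_norm_discKernel_le hα hw))

theorem bInner_holExt_discKernel {α : ℝ} (hα : -1 < α) (i : ImagUnit) {w : ℂ} (hw : ‖w‖ < 1)
    (f : bergmanSpace α i) : bInner ⟨_, holExt_discKernel_mem hα i hw⟩ f = restr i f w := by
  refine Eq.trans (integral_congr_ae ?_) (integral_star_discKernel_mul_restr hα f hw)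
  filter_upwards [ae_mem_ball_discMeasure α] with z hz
  simp only [restr_holExt i _ hz]

/-- The choice operator in `kernel` has its defining property as soon as some reproducing element
exists, and the extension of `discKernel` is one. -/
theorem bInner_kernel {α : ℝ} (hα : -1 < α) {i : ImagUnit} {w : ℂ} (hw : ‖w‖ < 1)
    (f : bergmanSpace α i) : bInner (kernel α i (pt i.1 w.re w.im)) f = restr i f w :=
  Classical.epsilon_spec (p := fun K : bergmanSpace α i => ∀ f : bergmanSpace α i,
    bInner K f = f.1 (pt i.1 w.re w.im)) ⟨_, bInner_holExt_discKernel hα i hw⟩ f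

theorem bInner_kernel_right {α : ℝ} (hα : -1 < α) {i : ImagUnit} {w : ℂ} (hw : ‖w‖ < 1)
    (f : bergmanSpace α i) : bInner f (kernel α i (pt i.1 w.re w.im)) = star (restr i f w) := by
  rw [← star_bInner, bInner_kernel hα hw]

theorem restr_kernel {α : ℝ} (hα : -1 < α) (i : ImagUnit) {w z : ℂ} (hw : ‖w‖ < 1) (hz : ‖z‖ < 1) :
    restr i (kernel α i (pt i.1 w.re w.im)) z = sliceEmb i (discKernel α w z) := by
  have e : kernel α i (pt i.1 w.re w.im) = ⟨_, holExt_discKernel_mem hα i hw⟩ := by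
    -- Uniqueness by symmetry: the value at `u` of any element reproducing at `w` is its product
    -- with `K_u`, hence the conjugate of `K_u(w)`.
    refine ext_restr fun u hu => ?_
    have hu' := mem_ball_zero_iff.mp hu
    rw [← bInner_kernel hα hu', ← bInner_kernel hα hu', ← star_bInner, bInner_kernel hα hw,
      ← bInner_holExt_discKernel hα i hw, star_bInner]
  rw [e]
  exact restr_holExt i _ (mem_ball_zero_iff.mpr hz)

/-- Point evaluation is bounded: `|f(z)| ≤ ‖K_z‖ ‖f‖`. -/
theorem eq_zero_of_bNorm_eq_zero {α : ℝ} (hα : -1 < α) {i : ImagUnit} {f : bergmanSpace α i}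
    (h : bNorm f = 0) : f = 0 := by
  refine eq_zero_of_restr_eq_zero fun z hz => ?_
  have h1 := norm_bInner_le (kernel α i (pt i.1 z.re z.im)) f
  rw [bInner_kernel hα (mem_ball_zero_iff.mp hz), h, mul_zero] at h1
  exact norm_le_zero_iff.mp h1

/-! ### The operator norm and the two-vector estimate. -/

theorem opNorm_nonneg {α : ℝ} {i : ImagUnit}
    (T : bergmanSpace α i →ₗ[(ℍ[ℝ])ᵐᵒᵖ] bergmanSpace α i) : 0 ≤ opNorm T :=
  Real.sSup_nonneg (by rintro r ⟨f, -, rfl⟩; exact bNorm_nonneg _)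

theorem bNorm_apply_le {α : ℝ} (hα : -1 < α) {i : ImagUnit}
    {T : bergmanSpace α i →ₗ[(ℍ[ℝ])ᵐᵒᵖ] bergmanSpace α i} (hT : IsBoundedOp T)
    (f : bergmanSpace α i) : bNorm (T f) ≤ opNorm T * bNorm f := by
  rcases eq_or_ne (bNorm f) 0 with h | h
  · rw [eq_zero_of_bNorm_eq_zero hα h, map_zero]
    have : bNorm (0 : bergmanSpace α i) = 0 := by
      have := bNorm_smul (0 : bergmanSpace α i) 0
      simpa using this
    rw [this, mul_zero]
  · have hp : 0 < bNorm f := lt_of_le_of_ne (bNorm_nonneg f) h.symm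
    have hn : ‖(((bNorm f)⁻¹ : ℝ) : ℍ[ℝ])‖ = (bNorm f)⁻¹ := by
      rw [Quaternion.norm_coe, Real.norm_of_nonneg (inv_nonneg.mpr hp.le)]
    have h1 : bNorm (T (op (((bNorm f)⁻¹ : ℝ) : ℍ[ℝ]) • f)) ≤ opNorm T := by
      refine le_csSup hT ⟨_, ?_, rfl⟩
      rw [bNorm_smul, hn, mul_inv_cancel₀ h]
    rwa [map_smul, bNorm_smul, hn, ← div_eq_mul_inv, div_le_iff₀ hp] at h1

/-- The difference of two diagonal values `⟨u, T u⟩`, `⟨v, T v⟩` at unit vectors with real scalar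
product `c` is at most `2 ‖T‖ √(1 - c²)`. -/
theorem norm_bInner_apply_sub_le {α : ℝ} (hα : -1 < α) {i : ImagUnit}
    {T : bergmanSpace α i →ₗ[(ℍ[ℝ])ᵐᵒᵖ] bergmanSpace α i} (hT : IsBoundedOp T)
    {u v : bergmanSpace α i} (hu : bNorm u = 1) (hv : bNorm v = 1) {c : ℝ}
    (huv : bInner u v = (c : ℍ[ℝ])) :
    ‖bInner u (T u) - bInner v (T v)‖ ≤ 2 * opNorm T * √(1 - c ^ 2) := by
  have hvu : bInner v u = (c : ℍ[ℝ]) := by rw [← star_bInner, huv, Quaternion.star_coe]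
  have hm : bNorm (u - v) ^ 2 = 2 - 2 * c := by
    rw [show 2 - 2 * c = 1 ^ 2 - c - (c - 1 ^ 2) by ring]
    apply Quaternion.coe_injective
    rw [← bInner_self, bInner_sub_left, bInner_sub_right, bInner_sub_right, bInner_self, bInner_self,
      huv, hvu, hu, hv]
    push_cast
    rfl
  have hp : bNorm (u + v) ^ 2 = 2 + 2 * c := by
    rw [show 2 + 2 * c = 1 ^ 2 + c + (c + 1 ^ 2) by ring]
    apply Quaternion.coe_injective
    rw [← bInner_self, bInner_add_left, bInner_add_right, bInner_add_right, bInner_self, bInner_self,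
      huv, hvu, hu, hv]
    push_cast
    rfl
  have hpm : bNorm (u - v) * bNorm (u + v) = 2 * √(1 - c ^ 2) := by
    rw [← Real.sqrt_sq (mul_nonneg (bNorm_nonneg (u - v)) (bNorm_nonneg (u + v))), mul_pow, hm, hp,
      show (2 - 2 * c) * (2 + 2 * c) = 2 ^ 2 * (1 - c ^ 2) by ring,
      Real.sqrt_mul (by positivity), Real.sqrt_sq zero_le_two]
  -- Polarization: the off-diagonal terms `⟨u, T v⟩` and `⟨v, T u⟩` cancel, and each summand
  -- contains one factor `u - v` and one factor `u + v`.
  have hid : (2 : ℝ) • (bInner u (T u) - bInner v (T v)) =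
      bInner (u - v) (T (u + v)) + bInner (u + v) (T (u - v)) := by
    rw [map_add, map_sub, bInner_sub_left, bInner_add_left, bInner_sub_right, bInner_sub_right,
      bInner_add_right, bInner_add_right, two_smul]
    abel
  have h1 : ‖bInner (u - v) (T (u + v))‖ ≤ bNorm (u - v) * (opNorm T * bNorm (u + v)) :=
    (norm_bInner_le _ _).trans
      (mul_le_mul_of_nonneg_left (bNorm_apply_le hα hT _) (bNorm_nonneg _))
  have h2 : ‖bInner (u + v) (T (u - v))‖ ≤ bNorm (u + v) * (opNorm T * bNorm (u - v)) :=
    (norm_bInner_le _ _).trans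
      (mul_le_mul_of_nonneg_left (bNorm_apply_le hα hT _) (bNorm_nonneg _))
  have h3 := norm_add_le (bInner (u - v) (T (u + v))) (bInner (u + v) (T (u - v)))
  rw [← hid, norm_smul, Real.norm_ofNat] at h3
  have h4 : opNorm T * (bNorm (u - v) * bNorm (u + v)) = opNorm T * (2 * √(1 - c ^ 2)) := by rw [hpm]
  linarith

/-! ### Normalized kernels, their overlaps and their phases. -/

theorem one_sub_norm_sq_pos {w : ℂ} (hw : ‖w‖ < 1) : 0 < 1 - ‖w‖ ^ 2 := by
  nlinarith [norm_nonneg w]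

theorem bNorm_kernel_sq {α : ℝ} (hα : -1 < α) (i : ImagUnit) {w : ℂ} (hw : ‖w‖ < 1) :
    bNorm (kernel α i (pt i.1 w.re w.im)) ^ 2 = (1 - ‖w‖ ^ 2) ^ (-(α + 2)) := by
  apply Quaternion.coe_injective
  rw [← bInner_self, bInner_kernel hα hw, restr_kernel hα i hw hw, discKernel_self α hw,
    sliceEmb_ofReal]

theorem normKernel_eq {α : ℝ} (hα : -1 < α) (i : ImagUnit) {w : ℂ} (hw : ‖w‖ < 1) :
    normKernel α i (pt i.1 w.re w.im) = op (((√((1 - ‖w‖ ^ 2) ^ (α + 2))) : ℝ) : ℍ[ℝ]) •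
      kernel α i (pt i.1 w.re w.im) := by
  have h : (kernel α i (pt i.1 w.re w.im)).1 (pt i.1 w.re w.im) =
      (((1 - ‖w‖ ^ 2) ^ (-(α + 2)) : ℝ) : ℍ[ℝ]) := by
    rw [← sliceEmb_ofReal i, ← discKernel_self α hw]
    exact restr_kernel hα i hw hw
  rw [normKernel, h, Quaternion.re_coe, Real.rpow_neg (one_sub_norm_sq_pos hw).le, Real.sqrt_inv,
    inv_inv]

theorem bNorm_normKernel {α : ℝ} (hα : -1 < α) (i : ImagUnit) {w : ℂ} (hw : ‖w‖ < 1) :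
    bNorm (normKernel α i (pt i.1 w.re w.im)) = 1 := by
  have h := one_sub_norm_sq_pos hw
  rw [← sq_eq_sq₀ (bNorm_nonneg _) zero_le_one, normKernel_eq hα i hw, bNorm_smul, mul_pow,
    bNorm_kernel_sq hα i hw, Quaternion.norm_coe, Real.norm_eq_abs, sq_abs, Real.sq_sqrt
    (Real.rpow_nonneg h.le _), ← Real.rpow_add h]
  simp

theorem bInner_normKernel {α : ℝ} (hα : -1 < α) (i : ImagUnit) {z w : ℂ} (hz : ‖z‖ < 1)
    (hw : ‖w‖ < 1) :
    bInner (normKernel α i (pt i.1 z.re z.im)) (normKernel α i (pt i.1 w.re w.im)) =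
      sliceEmb i ((√((1 - ‖z‖ ^ 2) ^ (α + 2)) : ℝ) * discKernel α w z *
        (√((1 - ‖w‖ ^ 2) ^ (α + 2)) : ℝ)) := by
  rw [normKernel_eq hα i hz, normKernel_eq hα i hw, bInner_smul_right, bInner_smul_left,
    bInner_kernel hα hz, restr_kernel hα i hw hz, Quaternion.star_coe, map_mul, map_mul,
    sliceEmb_ofReal, sliceEmb_ofReal]

theorem norm_sq_normKernel_product {α : ℝ} {z w : ℂ} (hz : ‖z‖ < 1) (hw : ‖w‖ < 1) :
    ‖((√((1 - ‖z‖ ^ 2) ^ (α + 2)) : ℝ) * discKernel α w z *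
        (√((1 - ‖w‖ ^ 2) ^ (α + 2)) : ℝ) : ℂ)‖ ^ 2 = (1 - ‖discInvolution w z‖ ^ 2) ^ (α + 2) := by
  have h1 := one_sub_norm_sq_pos hz
  have h2 := one_sub_norm_sq_pos hw
  have h3 : 0 < ‖1 - star w * z‖ := norm_pos_iff.mpr (one_sub_star_mul_ne_zero hw hz)
  rw [norm_mul, norm_mul, mul_pow, mul_pow, Complex.norm_real, Complex.norm_real, Real.norm_eq_abs,
    Real.norm_eq_abs, sq_abs, sq_abs, Real.sq_sqrt (Real.rpow_nonneg h1.le _),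
    Real.sq_sqrt (Real.rpow_nonneg h2.le _), norm_discKernel, one_sub_norm_sq_discInvolution hw hz,
    Real.div_rpow (by positivity) (by positivity), Real.mul_rpow h2.le h1.le, Real.rpow_neg h3.le,
    ← Real.rpow_pow_comm h3.le]
  field_simp

theorem isSliceValued_normKernel {α : ℝ} (hα : -1 < α) (i : ImagUnit) {w : ℂ} (hw : ‖w‖ < 1) :
    IsSliceValued (normKernel α i (pt i.1 w.re w.im)) := by
  refine ⟨fun z => discKernel α w z * (√((1 - ‖w‖ ^ 2) ^ (α + 2)) : ℝ), fun z hz => ?_⟩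
  rw [normKernel_eq hα i hw, restr_op_smul, restr_kernel hα i hw (mem_ball_zero_iff.mp hz), map_mul,
    sliceEmb_ofReal]

/-- The diagonal value of an operator commuting with `J` at a `ℂ_i`-valued function lies in `ℂ_i`. -/
theorem bInner_apply_comm {α : ℝ} {i : ImagUnit}
    {T : bergmanSpace α i →ₗ[(ℍ[ℝ])ᵐᵒᵖ] bergmanSpace α i} (hT : T ∘ₗ opJ α i = opJ α i ∘ₗ T)
    {f : bergmanSpace α i} (hf : IsSliceValued f) (c : ℂ) :
    bInner f (T f) * sliceEmb i c = sliceEmb i c * bInner f (T f) := by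
  have h1 := LinearMap.congr_fun hT f
  rw [LinearMap.comp_apply, LinearMap.comp_apply, opJ_of_isSliceValued hf, map_smul] at h1
  -- The right scalar `i` on `f` is `J f`; it moves through `T` as `J` and leaves the scalar product
  -- as a left factor `i`.
  have h2 : bInner f (T f) * i.1 = i.1 * bInner f (T f) := by
    rw [← bInner_smul_right, h1, bInner_opJ_right hf]
  rw [sliceEmb_apply, pt, mul_add, add_mul, Quaternion.mul_coe_eq_smul, Quaternion.coe_mul_eq_smul,
    Quaternion.mul_coe_eq_smul, mul_smul_comm, smul_mul_assoc, h2]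

/-- A right factor `c` conjugates the diagonal value to `c̄ ⟨f, T f⟩ c`, and this is trivial because
the value commutes with `ℂ_i`. -/
theorem bInner_smul_apply_smul {α : ℝ} {i : ImagUnit}
    {T : bergmanSpace α i →ₗ[(ℍ[ℝ])ᵐᵒᵖ] bergmanSpace α i} (hT : T ∘ₗ opJ α i = opJ α i ∘ₗ T)
    {f : bergmanSpace α i} (hf : IsSliceValued f) {c : ℂ} (hc : ‖c‖ = 1) :
    bInner (op (sliceEmb i c) • f) (T (op (sliceEmb i c) • f)) = bInner f (T f) := by
  rw [map_smul, bInner_smul_right, bInner_smul_left, mul_assoc, bInner_apply_comm hT hf, ← mul_assoc,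
    star_sliceEmb, ← map_mul, Complex.star_def, Complex.conj_mul', hc]
  simp

theorem exists_norm_one_mul_eq_norm (c : ℂ) : ∃ e : ℂ, ‖e‖ = 1 ∧ c * e = (‖c‖ : ℂ) := by
  rcases eq_or_ne c 0 with rfl | h
  · exact ⟨1, by simp⟩
  · have h' : ‖c‖ ≠ 0 := norm_ne_zero_iff.mpr h
    refine ⟨‖c‖ / c, by simp [h'], by field_simp⟩

/-! ### The Bergman metric and the Lipschitz estimate. -/

/-- With `t = artanh ρ` one has `1 - ρ² = (cosh t)⁻²`, and `cosh t ≤ exp (t² / 2)` makes this at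
least `exp (-t²)`. Raise to the power `s` and use `1 - exp (-x) ≤ x`. -/
theorem one_sub_rpow_le_artanh {ρ s : ℝ} (h0 : 0 ≤ ρ) (h1 : ρ < 1) (hs : 0 ≤ s) :
    1 - (1 - ρ ^ 2) ^ s ≤ s * Real.artanh ρ ^ 2 := by
  have hρ : 0 < 1 - ρ ^ 2 := by nlinarith
  have h2 := Real.cosh_le_exp_half_sq (Real.artanh ρ)
  rw [Real.cosh_artanh ⟨by linarith, h1⟩, div_le_iff₀ (Real.sqrt_pos.mpr hρ)] at h2
  have h3 : Real.exp (-Real.artanh ρ ^ 2) ≤ 1 - ρ ^ 2 := by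
    have h4 : Real.exp (-(Real.artanh ρ ^ 2 / 2)) ≤ √(1 - ρ ^ 2) := by
      rw [Real.exp_neg, inv_le_iff_one_le_mul₀' (Real.exp_pos _)]
      exact h2
    have h5 := pow_le_pow_left₀ (Real.exp_pos _).le h4 2
    rw [Real.sq_sqrt hρ.le, ← Real.exp_nat_mul] at h5
    rwa [show ((2 : ℕ) : ℝ) * -(Real.artanh ρ ^ 2 / 2) = -Real.artanh ρ ^ 2 by push_cast; ring] at h5
  have h6 := Real.rpow_le_rpow (Real.exp_pos _).le h3 hs
  rw [← Real.exp_mul] at h6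
  have h7 := Real.add_one_le_exp (-Real.artanh ρ ^ 2 * s)
  nlinarith

theorem pseudoHyp_pt (i : ImagUnit) (z w : ℂ) :
    pseudoHyp (pt i.1 z.re z.im) (pt i.1 w.re w.im) = ‖discInvolution w z‖ := by
  rw [pseudoHyp, ← sliceEmb_apply, ← sliceEmb_apply, star_sliceEmb, ← map_sub, ← map_mul,
    ← map_one (sliceEmb i), ← map_sub, norm_sliceEmb, norm_sliceEmb, discInvolution, norm_div,
    norm_sub_rev, mul_comm]

theorem bergmanMetric_pt (i : ImagUnit) {z w : ℂ} (hz : ‖z‖ < 1) (hw : ‖w‖ < 1) :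
    bergmanMetric (pt i.1 z.re z.im) (pt i.1 w.re w.im) = Real.artanh ‖discInvolution w z‖ := by
  rw [bergmanMetric, pseudoHyp_pt, Real.artanh_eq_half_log]
  exact ⟨by linarith [norm_nonneg (discInvolution w z)], (norm_discInvolution_lt hw hz).le⟩

theorem exists_of_mem_sliceDisc {i : ImagUnit} {q : ℍ[ℝ]} (hq : q ∈ sliceDisc i) :
    ∃ z : ℂ, ‖z‖ < 1 ∧ q = pt i.1 z.re z.im := by
  obtain ⟨h1, x, y, rfl⟩ := hq
  exact ⟨⟨x, y⟩, mem_ball_zero_iff.mp ((mem_ball_iff_pt i ⟨x, y⟩).mp h1), rfl⟩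

/-- The Lipschitz estimate for the Berezin transform. -/
theorem norm_berezin_sub_le {α : ℝ} (hα : -1 < α) {i : ImagUnit}
    {T : bergmanSpace α i →ₗ[(ℍ[ℝ])ᵐᵒᵖ] bergmanSpace α i} (hT : T ∈ boundedCommJ α i)
    {z w : ℂ} (hz : ‖z‖ < 1) (hw : ‖w‖ < 1) :
    ‖berezin T (pt i.1 z.re z.im) - berezin T (pt i.1 w.re w.im)‖ ≤
      2 * √(2 + α) * opNorm T * bergmanMetric (pt i.1 z.re z.im) (pt i.1 w.re w.im) := by
  have hc := norm_sq_normKernel_product (α := α) hz hw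
  have hk := bInner_normKernel hα i hz hw
  generalize ((√((1 - ‖z‖ ^ 2) ^ (α + 2)) : ℝ) * discKernel α w z *
        (√((1 - ‖w‖ ^ 2) ^ (α + 2)) : ℝ) : ℂ) = c at hc hk
  -- The phase `e` makes the overlap of `k_z` with `k_w e` equal to `|c|`, as the two-vector
  -- estimate requires a real scalar product.
  obtain ⟨e, he, hce⟩ := exists_norm_one_mul_eq_norm c
  have hv : bNorm (op (sliceEmb i e) • normKernel α i (pt i.1 w.re w.im)) = 1 := by
    rw [bNorm_smul, bNorm_normKernel hα i hw, norm_sliceEmb, he, one_mul]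
  have huv : bInner (normKernel α i (pt i.1 z.re z.im))
      (op (sliceEmb i e) • normKernel α i (pt i.1 w.re w.im)) = ((‖c‖ : ℝ) : ℍ[ℝ]) := by
    rw [bInner_smul_right, hk, ← map_mul, hce, sliceEmb_ofReal]
  have h := norm_bInner_apply_sub_le hα hT.1 (bNorm_normKernel hα i hz) hv huv
  rw [bInner_smul_apply_smul hT.2 (isSliceValued_normKernel hα i hw) he, hc] at h
  refine h.trans ?_
  have hρ := norm_discInvolution_lt hw hz
  have h1 : √(1 - (1 - ‖discInvolution w z‖ ^ 2) ^ (α + 2)) ≤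
      √(2 + α) * Real.artanh ‖discInvolution w z‖ := by
    rw [← Real.sqrt_sq (Real.artanh_nonneg (norm_nonneg (discInvolution w z))),
      ← Real.sqrt_mul (by linarith), add_comm 2 α]
    exact Real.sqrt_le_sqrt (one_sub_rpow_le_artanh (norm_nonneg _) hρ (by linarith))
  rw [bergmanMetric_pt i hz hw]
  calc 2 * opNorm T * √(1 - (1 - ‖discInvolution w z‖ ^ 2) ^ (α + 2))
      ≤ 2 * opNorm T * (√(2 + α) * Real.artanh ‖discInvolution w z‖) :=
        mul_le_mul_of_nonneg_left h1 (mul_nonneg zero_le_two (opNorm_nonneg T))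
    _ = _ := by ring

/-! ### Sharpness: the swap of two orthonormal functions. -/

/-- The operator `f ↦ u ⟨v, f⟩ + v ⟨u, f⟩`. -/
noncomputable def swapOp {α : ℝ} {i : ImagUnit} (u v : bergmanSpace α i) :
    bergmanSpace α i →ₗ[(ℍ[ℝ])ᵐᵒᵖ] bergmanSpace α i where
  toFun f := op (bInner v f) • u + op (bInner u f) • v
  map_add' f g := by
    rw [bInner_add_right, bInner_add_right, op_add, op_add, add_smul, add_smul]
    abel
  map_smul' c f := by
    obtain ⟨c, rfl⟩ := op_surjective c
    rw [bInner_smul_right, bInner_smul_right, op_mul, op_mul, mul_smul, mul_smul, RingHom.id_apply,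
      smul_add]

theorem swapOp_apply {α : ℝ} {i : ImagUnit} (u v f : bergmanSpace α i) :
    swapOp u v f = op (bInner v f) • u + op (bInner u f) • v := rfl

section

variable {α : ℝ} {i : ImagUnit} {u v : bergmanSpace α i}

/-- By orthonormality the image has squared norm `|⟨v, f⟩|² + |⟨u, f⟩|²`, which Bessel's inequality
bounds by `‖f‖²`. -/
theorem bNorm_swapOp_le (hu : bNorm u = 1) (hv : bNorm v = 1)
    (huv : bInner u v = 0) (f : bergmanSpace α i) : bNorm (swapOp u v f) ≤ bNorm f := by
  have hvu : bInner v u = 0 := by rw [← star_bInner, huv, star_zero]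
  have huu : bInner u u = 1 := by rw [bInner_self, hu]; simp
  have hvv : bInner v v = 1 := by rw [bInner_self, hv]; simp
  have e : ∀ q : ℍ[ℝ], star q * q = ((‖q‖ ^ 2 : ℝ) : ℍ[ℝ]) := fun q => by
    rw [Quaternion.star_mul_self, Quaternion.normSq_eq_norm_mul_self, sq]
  have h1 : bNorm (swapOp u v f) ^ 2 = ‖bInner v f‖ ^ 2 + ‖bInner u f‖ ^ 2 := by
    apply Quaternion.coe_injective
    rw [← bInner_self, Quaternion.coe_add, ← e, ← e, swapOp_apply]
    simp only [bInner_add_left, bInner_add_right, bInner_smul_left, bInner_smul_right, huu, hvv, huv,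
      hvu, mul_zero, mul_one, add_zero, zero_add]
  -- Bessel's inequality, from the squared distance of `f` to the span of `u` and `v`.
  have h2 : bNorm (f - (op (bInner u f) • u + op (bInner v f) • v)) ^ 2 =
      bNorm f ^ 2 - (‖bInner u f‖ ^ 2 + ‖bInner v f‖ ^ 2) := by
    apply Quaternion.coe_injective
    rw [← bInner_self, Quaternion.coe_sub, Quaternion.coe_add, ← e, ← e, ← bInner_self]
    simp only [bInner_add_left, bInner_add_right, bInner_smul_left, bInner_smul_right, huu, hvv, huv,
      hvu, mul_zero, mul_one, add_zero, zero_add, bInner_sub_left, bInner_sub_right]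
    rw [← star_bInner u f, ← star_bInner v f]
    simp only [sub_self, zero_mul]
    abel
  refine (sq_le_sq₀ (bNorm_nonneg _) (bNorm_nonneg _)).mp ?_
  have h3 := sq_nonneg (bNorm (f - (op (bInner u f) • u + op (bInner v f) • v)))
  linarith

theorem isBoundedOp_swapOp (hu : bNorm u = 1) (hv : bNorm v = 1) (huv : bInner u v = 0) :
    IsBoundedOp (swapOp u v) :=
  ⟨1, by rintro r ⟨f, hf, rfl⟩; exact hf ▸ bNorm_swapOp_le hu hv huv f⟩

theorem opNorm_swapOp_le (hu : bNorm u = 1) (hv : bNorm v = 1) (huv : bInner u v = 0) :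
    opNorm (swapOp u v) ≤ 1 :=
  Real.sSup_le (by rintro r ⟨f, hf, rfl⟩; exact hf ▸ bNorm_swapOp_le hu hv huv f) zero_le_one

/-- Both sides insert an `i` between the vector and the coefficient: `⟨v, J f⟩ = i ⟨v, f⟩` and `J u
= u i`, likewise with `u` and `v` exchanged. -/
theorem swapOp_comm_opJ (hu : IsSliceValued u) (hv : IsSliceValued v) :
    swapOp u v ∘ₗ opJ α i = opJ α i ∘ₗ swapOp u v := by
  ext1 f
  rw [LinearMap.comp_apply, LinearMap.comp_apply, swapOp_apply, swapOp_apply, bInner_opJ_right hu,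
    bInner_opJ_right hv, map_add, map_smul, map_smul, opJ_of_isSliceValued hu,
    opJ_of_isSliceValued hv, op_mul, op_mul, mul_smul, mul_smul]

end

/-- The monomial `√(α + 2) z` in the Bergman space. -/
theorem holExt_linear_mem {α : ℝ} (hα : -1 < α) (i : ImagUnit) :
    holExt i (fun z => (√(α + 2) : ℂ) * z) ∈ bergmanSpace α i := by
  have := isProbabilityMeasure_discMeasure hα
  refine holExt_mem i (differentiable_id.const_mul _).differentiableOn
    (MemLp.of_bound (measurable_const_mul _).aestronglyMeasurable (√(α + 2)) ?_)
  filter_upwards [ae_mem_ball_discMeasure α] with z hz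
  rw [norm_mul, Complex.norm_real, Real.norm_of_nonneg (Real.sqrt_nonneg _)]
  exact mul_le_of_le_one_right (Real.sqrt_nonneg _) (mem_ball_zero_iff.mp hz).le

theorem bNorm_holExt_linear {α : ℝ} (hα : -1 < α) (i : ImagUnit) :
    bNorm (⟨_, holExt_linear_mem hα i⟩ : bergmanSpace α i) = 1 := by
  rw [← sq_eq_sq₀ (bNorm_nonneg _) zero_le_one, bNorm_sq]
  have h : ∫ z, ‖restr i (holExt i fun z => (√(α + 2) : ℂ) * z) z‖ ^ 2 ∂discMeasure α =
      ∫ z : ℂ, (α + 2) * ‖z‖ ^ 2 ∂discMeasure α := by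
    refine integral_congr_ae ?_
    filter_upwards [ae_mem_ball_discMeasure α] with z hz
    rw [restr_holExt i _ hz, norm_sliceEmb, norm_mul, mul_pow, Complex.norm_real, Real.norm_eq_abs,
      sq_abs, Real.sq_sqrt (by linarith)]
  rw [h, integral_const_mul, integral_norm_sq_discMeasure hα, one_pow, mul_one_div_cancel]
  linarith

theorem berezin_pt {α : ℝ} (hα : -1 < α) {i : ImagUnit}
    (T : bergmanSpace α i →ₗ[(ℍ[ℝ])ᵐᵒᵖ] bergmanSpace α i) {w : ℂ} (hw : ‖w‖ < 1) :
    berezin T (pt i.1 w.re w.im) = (1 - ‖w‖ ^ 2) ^ (α + 2) •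
      restr i (T (kernel α i (pt i.1 w.re w.im))) w := by
  rw [berezin, normKernel_eq hα i hw, map_smul, bInner_smul_right, bInner_smul_left,
    bInner_kernel hα hw, Quaternion.star_coe, Quaternion.mul_coe_eq_smul, Quaternion.coe_mul_eq_smul,
    smul_smul, Real.mul_self_sqrt (Real.rpow_nonneg (one_sub_norm_sq_pos hw).le _)]

/-- This is `t ≤ sinh t` at `t = artanh r`; the bound has the exact slope `1` at `0`. -/
theorem artanh_le {r : ℝ} (h0 : 0 ≤ r) (h1 : r < 1) : Real.artanh r ≤ r / √(1 - r ^ 2) := by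
  rw [← Real.sinh_artanh ⟨by linarith, h1⟩]
  exact Real.self_le_sinh_iff.mpr (Real.artanh_nonneg h0)

/-- A linear bound by `artanh` near zero controls the slope. -/
theorem le_of_forall_le_artanh {A D s : ℝ} (hA : 0 ≤ A)
    (h : ∀ r ∈ Set.Ioo (0 : ℝ) 1, A * r * (1 - r ^ 2) ^ s ≤ D * Real.artanh r) : A ≤ D := by
  have h1 : ∀ r ∈ Set.Ioo (0 : ℝ) 1, A * (1 - r ^ 2) ^ s * √(1 - r ^ 2) ≤ D := by
    intro r hr
    have hr1 : 0 < 1 - r ^ 2 := by nlinarith [hr.1, hr.2]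
    have hs := Real.sqrt_pos.mpr hr1
    have hp := Real.rpow_pos_of_pos hr1 s
    -- The upper bound for `artanh` may be multiplied by `D` only if `D` is nonnegative.
    have hD : 0 ≤ D := by
      by_contra! hD
      have h2 := h r hr
      have h3 := mul_neg_of_neg_of_pos hD (Real.artanh_pos hr)
      have h4 : 0 ≤ A * r * (1 - r ^ 2) ^ s := mul_nonneg (mul_nonneg hA hr.1.le) hp.le
      linarith
    have h2 := (h r hr).trans (mul_le_mul_of_nonneg_left (artanh_le hr.1.le hr.2) hD)
    rw [mul_div_assoc', le_div_iff₀ hs] at h2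
    refine le_of_mul_le_mul_right ?_ hr.1
    linarith
  have hc : Filter.Tendsto (fun r : ℝ => A * (1 - r ^ 2) ^ s * √(1 - r ^ 2))
      (nhdsWithin 0 (Set.Ioi 0)) (nhds A) := by
    have h3 : ContinuousAt (fun r : ℝ => 1 - r ^ 2) 0 := by fun_prop
    have h2 : ContinuousAt (fun r : ℝ => A * (1 - r ^ 2) ^ s * √(1 - r ^ 2)) 0 :=
      (continuousAt_const.mul (h3.rpow_const (Or.inl (by simp)))).mul h3.sqrt
    have h4 := h2.tendsto
    simp only [ne_eq, OfNat.ofNat_ne_zero, not_false_eq_true, zero_pow, sub_zero, Real.one_rpow,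
      mul_one, Real.sqrt_one] at h4
    exact h4.mono_left nhdsWithin_le_nhds
  refine le_of_tendsto hc ?_
  filter_upwards [Ioo_mem_nhdsGT zero_lt_one] with r hr using h1 r hr

theorem bergmanMetric_ofReal_zero (i : ImagUnit) {r : ℝ} (h0 : 0 ≤ r) (h1 : r < 1) :
    bergmanMetric (pt i.1 (r : ℂ).re (r : ℂ).im) (pt i.1 (0 : ℂ).re (0 : ℂ).im) =
      Real.artanh r := by
  have hr : ‖(r : ℂ)‖ < 1 := by simpa [abs_of_nonneg h0] using h1
  rw [bergmanMetric_pt i hr (by simp)]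
  simp [discInvolution, abs_of_nonneg h0]

/-- The constant in the Lipschitz estimate is optimal. -/
theorem le_of_lipschitz_berezin {α : ℝ} (hα : -1 < α) (i : ImagUnit) {C : ℝ}
    (hC : ∀ T ∈ boundedCommJ α i, ∀ z ∈ sliceDisc i, ∀ w ∈ sliceDisc i,
      ‖berezin T z - berezin T w‖ ≤ C * opNorm T * bergmanMetric z w) :
    2 * √(2 + α) ≤ C := by
  have h0 : ‖(0 : ℂ)‖ < 1 := by simp
  -- The pair consists of the constant `1`, which is the kernel at `0`, and the normalized monomial
  -- of degree one; `α + 2` is the inverse of the second moment.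
  let u : bergmanSpace α i := kernel α i (pt i.1 (0 : ℂ).re (0 : ℂ).im)
  let v : bergmanSpace α i := ⟨_, holExt_linear_mem hα i⟩
  have hru : ∀ z : ℂ, ‖z‖ < 1 → restr i u z = 1 := fun z hz => by
    rw [restr_kernel hα i h0 hz]; simp [discKernel]
  have hrv : ∀ z : ℂ, ‖z‖ < 1 → restr i v z = sliceEmb i ((√(α + 2) : ℂ) * z) := fun z hz =>
    restr_holExt i _ (mem_ball_zero_iff.mpr hz)
  have hu : bNorm u = 1 := by
    rw [← sq_eq_sq₀ (bNorm_nonneg _) zero_le_one, bNorm_kernel_sq hα i h0]; simp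
  have hv : bNorm v = 1 := bNorm_holExt_linear hα i
  have huv : bInner u v = 0 := by rw [bInner_kernel hα h0, hrv 0 h0]; simp
  have hus : IsSliceValued u := ⟨_, fun z hz => restr_kernel hα i h0 (mem_ball_zero_iff.mp hz)⟩
  have hvs : IsSliceValued v := ⟨_, fun z hz => hrv z (mem_ball_zero_iff.mp hz)⟩
  have hT : swapOp u v ∈ boundedCommJ α i :=
    ⟨isBoundedOp_swapOp hu hv huv, swapOp_comm_opJ hus hvs⟩
  have hval : ∀ r : ℝ, 0 ≤ r → r < 1 → berezin (swapOp u v) (pt i.1 (r : ℂ).re (r : ℂ).im) =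
      ((2 * √(2 + α) * r * (1 - r ^ 2) ^ (α + 2) : ℝ) : ℍ[ℝ]) := by
    intro r hr0 hr1
    have hr : ‖(r : ℂ)‖ < 1 := by simpa [abs_of_nonneg hr0] using hr1
    rw [berezin_pt hα _ hr, swapOp_apply, restr_add, restr_op_smul, restr_op_smul,
      bInner_kernel_right hα hr, bInner_kernel_right hα hr, hru _ hr, hrv _ hr,
      ← Complex.ofReal_mul, sliceEmb_ofReal, Quaternion.star_coe, star_one, one_mul, mul_one,
      ← Quaternion.coe_add, Quaternion.smul_coe, Complex.norm_real, Real.norm_of_nonneg hr0,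
      add_comm 2 α]
    congr 1
    ring
  have hD : 2 * √(2 + α) ≤ C * opNorm (swapOp u v) := by
    refine le_of_forall_le_artanh (s := α + 2) (by positivity) fun r hr => ?_
    have hr' : ‖(r : ℂ)‖ < 1 := by simpa [abs_of_pos hr.1] using hr.2
    have h := hC _ hT _ ⟨(mem_ball_iff_pt i (r : ℂ)).mpr (mem_ball_zero_iff.mpr hr'), _, _, rfl⟩ _
      ⟨(mem_ball_iff_pt i (0 : ℂ)).mpr (mem_ball_zero_iff.mpr h0), _, _, rfl⟩
    have hz := hval 0 le_rfl zero_lt_one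
    rw [Complex.ofReal_zero] at hz
    rw [bergmanMetric_ofReal_zero i hr.1.le hr.2, hval r hr.1.le hr.2, hz] at h
    refine le_trans (le_of_eq ?_) h
    have hp : 0 ≤ (1 - r ^ 2) ^ (α + 2) := Real.rpow_nonneg (by nlinarith [hr.1, hr.2]) _
    rw [mul_zero, zero_mul, Quaternion.coe_zero, sub_zero, Quaternion.norm_coe, Real.norm_of_nonneg]
    exact mul_nonneg (mul_nonneg (by positivity) hr.1.le) hp
  have hn := opNorm_nonneg (swapOp u v)
  have hs : 0 < 2 * √(2 + α) := mul_pos two_pos (Real.sqrt_pos.mpr (by linarith))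
  -- Positivity of `C` is needed to discard the factor `‖T‖`, which is only known to be at most `1`.
  have hC0 : 0 < C := pos_of_mul_pos_left (hs.trans_le hD) hn
  exact hD.trans (mul_le_of_le_one_right hC0.le (opNorm_swapOp_le hu hv huv))

end SliceBergman

theorem mainTheorem7 (α : ℝ) (hα : -1 < α) (i : SliceBergman.ImagUnit) :
    (∀ T ∈ SliceBergman.boundedCommJ α i,
      ∀ z ∈ SliceBergman.sliceDisc i, ∀ w ∈ SliceBergman.sliceDisc i,
        ‖SliceBergman.berezin T z - SliceBergman.berezin T w‖ ≤
          2 * √(2 + α) * SliceBergman.opNorm T * SliceBergman.bergmanMetric z w) ∧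
    (∀ C : ℝ,
      (∀ T ∈ SliceBergman.boundedCommJ α i,
        ∀ z ∈ SliceBergman.sliceDisc i, ∀ w ∈ SliceBergman.sliceDisc i,
          ‖SliceBergman.berezin T z - SliceBergman.berezin T w‖ ≤
            C * SliceBergman.opNorm T * SliceBergman.bergmanMetric z w) →
      2 * √(2 + α) ≤ C) := by
  refine ⟨fun T hT z hz w hw => ?_, fun C hC => SliceBergman.le_of_lipschitz_berezin hα i hC⟩
  obtain ⟨z, hz', rfl⟩ := SliceBergman.exists_of_mem_sliceDisc hz
  obtain ⟨w, hw', rfl⟩ := SliceBergman.exists_of_mem_sliceDisc hw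
  exact SliceBergman.norm_berezin_sub_le hα hT hz' hw'
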